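/- **Setting.** Let $d\ge 2$, let $\Omega\subset\mathbb R^d$ be a bounded open set, and let $\mathcal T$ be a finite conforming triangulation of $\overline\Omega$ into nondegenerate closed $d$-simplices which is shape regular with parameter $\sigma$ (every $T\in\mathcal T$ contains a ball of diameter $\rho_T$ with $\operatorname{diam}T\le\sigma\rho_T$). Let $\kappa$ be positive and constant, with value $\kappa_T$, on each $T\in\mathcal T$. Let $\mathcal E$ be the set of $(d-1)$-dimensional faces of the simplices, $|e|$ the $(d-1)$-dimensional measure of $e\in\mathcal E$, $m_e$ its mass center, and let $h_e$ be the size of $e$: either $h_e=|e|$ for all $e$, or $h_e=\operatorname{diam}e$ for all $e$. A face is interior if it is shared by two simplices, $e=\partial T^+\cap\partial T^-$ (the labelling by $\pm$ is arbitrary), and otherwise it is a boundary face, contained in one simplex $T$. Write $n^\pm$ (resp. $n$) for the outward unit normals. On an interior face put $$\beta_e=\frac{\kappa^-}{\kappa^++\kappa^-},\qquad \kappa_e=\frac{2\kappa^+\kappa^-}{\kappa^++\kappa^-},\qquad [\![v]\!]=v^+n^++v^-n^-,$$ $$\{\kappa\nabla v\}_{\beta_e}=\beta_e\kappa^+\nabla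 v^++(1-\beta_e)\kappa^-\nabla v^-,\qquad \{v\}_{1-\beta_e}=(1-\beta_e)v^++\beta_ev^-,$$ and on a boundary face $\kappa_e=\kappa_T$, $[\![v]\!]=vn$, $\{\kappa\nabla v\}_{\beta_e}=\kappa_T\nabla v$. Let $V$ be the space of functions that are affine on each $T\in\mathcal T$, without any continuity, and let $P^0_e$ be the $L^2(e)$-projection onto constants (the mean value over $e$). For $\theta\in\{-1,0,1\}$ and $\alpha>0$ the IP($\beta$)-0 form on $V$ is $$\mathcal A_0(v,w)=\sum_{T}\int_T\kappa_T\nabla v\cdot\nabla w-\sum_{e}\int_e\{\kappa\nabla v\}_{\beta_e}\cdot[\![w]\!]+\theta\sum_{e}\int_e[\![v]\!]\cdot\{\kappa\nabla w\}_{\beta_e}+\sum_{e}\int_e\alpha h_e^{-1}\kappa_e\,P^0_e([\![v]\!])\cdot[\![w]\!].$$ Let $\mathcal Z_\beta=\{z\in V: P^0_e(\{z\}_{1-\beta_e})=0\text{ for every interior face }e\}$. Let $\varphi_{e,T}$ be the function which is affine on $T$, equal to $1$ at $m_e$ and to $0$ at the mass centers of the other faces of $T$, and zero on all other simplices. Put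 $\psi_e=\beta_e\varphi_{e,T^+}-(1-\beta_e)\varphi_{e,T^-}$ on interior faces and $\psi_e=\varphi_{e,T}$ on boundary faces. Let $\mathbb A=(\mathcal A_0(\psi_{e'},\psi_e))_{e,e'\in\mathcal E}$. **Lemma 4.2.** Fix $d$, $\Omega$, $\sigma$, $\theta$ and the choice of $h_e$. There is $\alpha_0>0$ such that for every $\alpha>0$, with $\alpha\ge\alpha_0$ if $\theta\ne1$, there are constants $c,C>0$ and $\rho\in[0,1)$, depending only on $d,\Omega,\sigma,\theta,\alpha$ and the choice of $h_e$ (so not on the triangulation, its mesh size or $\kappa$), such that for all triangulations $\mathcal T$ and coefficients $\kappa$ as above the following holds. 1. Every $z\in\mathcal Z_\beta$ has a unique representation $z=\sum_{e\in\mathcal E}z_e\psi_e$, $z_e\in\mathbb R$, and $$c\sum_{e\in\mathcal E}\frac{|e|}{h_e}\kappa_ez_e^2\;\le\;\mathcal A_0(z,z)\;\le\;C\sum_{e\in\mathcal E}\frac{|e|}{h_e}\kappa_ez_e^2 .$$ 2. Consequently, $\mathbb A$ is symmetric positive definite and diagonally preconditioned CG converges uniformly: let $D$ be either the diagonal of $\mathbb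 A$ or the diagonal matrix with entries $\frac{|e|}{h_e}\kappa_e$. For every right-hand side $b$ with solution $x$ of $\mathbb Ax=b$ and every initial guess $x_0$, the iterates $x_k$ of the conjugate gradient method for $\mathbb A$ with preconditioner $D$ satisfy $$\|x-x_k\|_{\mathbb A}\le\rho^k\,\|x-x_0\|_{\mathbb A}\qquad(k=0,1,2,\dots),\qquad \|y\|_{\mathbb A}=\sqrt{y^{T}\mathbb Ay}.$$ -/

import Mathlib

open MeasureTheory
open scoped Matrix

noncomputable section

/-- The Euclidean space `ℝ^d`. -/
abbrev Euc (d : ℕ) : Type := EuclideanSpace ℝ (Fin d)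

/-- A finite conforming mesh of nondegenerate `d`-simplices in `ℝ^d`; every simplex is given by its
set of `d + 1` vertices.  `conforming` says that two simplices meet only in a common
(possibly empty) subsimplex, i.e. there are no hanging nodes. -/
structure SimplicialMesh (d : ℕ) where
  cells : Finset (Finset (Euc d))
  card_cell : ∀ T ∈ cells, T.card = d + 1
  affineIndependent : ∀ T ∈ cells, AffineIndependent ℝ ((↑) : T → Euc d)
  conforming : ∀ T ∈ cells, ∀ T' ∈ cells,
    convexHull ℝ (T : Set (Euc d)) ∩ convexHull ℝ (T' : Set (Euc d)) ⊆
      convexHull ℝ ((T : Set (Euc d)) ∩ (T' : Set (Euc d)))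

namespace SimplicialMesh

variable {d : ℕ} (M : SimplicialMesh d)

/-- The simplices of the mesh (as vertex sets). -/
abbrev Cell : Type := {T : Finset (Euc d) // T ∈ M.cells}

open Classical in
/-- The vertex sets of the `(d-1)`-dimensional faces of the simplices of the mesh. -/
def faces : Finset (Finset (Euc d)) := M.cells.biUnion fun T => T.powersetCard d

/-- The faces (edges if `d = 2`) of the mesh, interior and boundary ones. -/
abbrev Face : Type := {F : Finset (Euc d) // F ∈ M.faces}

/-- The closed simplex spanned by a finite set of vertices. -/
abbrev hull (S : Finset (Euc d)) : Set (Euc d) := convexHull ℝ (S : Set (Euc d))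

/-- The mesh is a partition of the closure of `Ω`. -/
def Triangulates (Ω : Set (Euc d)) : Prop := closure Ω = ⋃ T : M.Cell, hull T.1

/-- Shape regularity with parameter `σ`: every simplex `T` contains a ball whose diameter `2 r`
satisfies `diam T ≤ σ * (2 r)`. -/
def ShapeRegular (σ : ℝ) : Prop :=
  ∀ T : M.Cell, ∃ (x : Euc d) (r : ℝ), 0 < r ∧ Metric.closedBall x r ⊆ hull T.1 ∧
    Metric.diam (hull T.1) ≤ σ * (2 * r)

/-- A face is interior if it is shared by two different simplices; otherwise it is a
boundary face. -/
def IsInterior (F : M.Face) : Prop := ∃ T T' : M.Cell, T ≠ T' ∧ F.1 ⊆ T.1 ∧ F.1 ⊆ T'.1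

/-- The vertices of a simplex as an affine basis of `ℝ^d`; its coordinate functions are the
barycentric coordinates. -/
def cellBasis (T : M.Cell) : AffineBasis T.1 ℝ (Euc d) where
  toFun := (↑)
  ind' := M.affineIndependent T.1 T.2
  tot' := by
    rw [(M.affineIndependent T.1 T.2).affineSpan_eq_top_iff_card_eq_finrank_add_one]
    simp [M.card_cell T.1 T.2]

open Classical in
/-- For a face `F` of the simplex `T`: the barycentric coordinate of `T` belonging to the vertex
opposite to `F`.  (The sum has exactly one term.)  It vanishes on `F`. -/
def oppCoord (T : M.Cell) (F : M.Face) : Euc d →ᵃ[ℝ] ℝ :=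
  ∑ v : T.1, if v.1 ∈ F.1 then 0 else (M.cellBasis T).coord v

/-- The outward unit normal of the simplex `T` on its face `F`. -/
def normal (T : M.Cell) (F : M.Face) : Euc d :=
  -(‖gradient (M.oppCoord T F) 0‖⁻¹ • gradient (M.oppCoord T F) 0)

/-- The mass center of a face. -/
def massCenter (F : M.Face) : Euc d := F.1.centroid ℝ id

/-- The piecewise linear discontinuous finite element space `V_h^{DG}`: an affine function on
every simplex. -/
abbrev DG : Type := M.Cell → (Euc d →ᵃ[ℝ] ℝ)

open Classical in
/-- The canonical Crouzeix-Raviart function of the face `F` of `T`: it is affine on `T`, equals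
`1` at the mass center of `F` and `0` at the mass centers of the other faces of `T`
(see `crBasis_massCenter`), and it vanishes on all other simplices. -/
def crBasis (F : M.Face) (T : M.Cell) : M.DG := fun T' =>
  if T' = T then AffineMap.const ℝ (Euc d) 1 - (d : ℝ) • M.oppCoord T F else 0

/-- The `(d-1)`-dimensional measure `|F|` of a face. -/
def area (F : M.Face) : ℝ := (μHE[d - 1] : Measure (Euc d)).real (hull F.1)

/-- The surface integral over a face. -/
def faceInt (F : M.Face) (g : Euc d → ℝ) : ℝ := ∫ x in hull F.1, g x ∂(μHE[d - 1] : Measure (Euc d))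

/-- The value on the face `F` of the `L²`-projection of `g` onto the piecewise constants:
the mean value over `F`. -/
def proj0 {V : Type*} [NormedAddCommGroup V] [NormedSpace ℝ V] (F : M.Face) (g : Euc d → V) : V :=
  ⨍ x in hull F.1, g x ∂(μHE[d - 1] : Measure (Euc d))

/-- The two ways to measure the size `h_F` of a face: its `(d-1)`-dimensional measure or
its diameter (they agree if `d = 2`). -/
inductive SizeKind where
  | measure
  | diameter

/-- The size `h_F` of a face. -/
def faceSize (s : SizeKind) (F : M.Face) : ℝ :=
  match s with
  | .measure => M.area F
  | .diameter => Metric.diam (hull F.1)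

/-- A labelling of the two simplices at every interior face `F = ∂T⁺ ∩ ∂T⁻` by `+` and `-`.
At a boundary face both are the only simplex containing it. -/
structure Labelling where
  plus : M.Face → M.Cell
  minus : M.Face → M.Cell
  subset_plus : ∀ F, F.1 ⊆ (plus F).1
  subset_minus : ∀ F, F.1 ⊆ (minus F).1
  plus_ne_minus : ∀ F, M.IsInterior F → plus F ≠ minus F

namespace Labelling

variable {M} (L : M.Labelling) (κ : M.Cell → ℝ)

/-- `β_F = κ⁻ / (κ⁺ + κ⁻)`, used on interior faces. -/
def beta (F : M.Face) : ℝ := κ (L.minus F) / (κ (L.plus F) + κ (L.minus F))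

open Classical in
/-- `κ_F`: the harmonic mean of `κ⁺` and `κ⁻` on an interior face, and the value of `κ` on the
adjacent simplex on a boundary face. -/
def kappaFace (F : M.Face) : ℝ :=
  if M.IsInterior F then
    2 * κ (L.plus F) * κ (L.minus F) / (κ (L.plus F) + κ (L.minus F))
  else κ (L.plus F)

open Classical in
/-- The jump `v⁺ n⁺ + v⁻ n⁻` on an interior face, `v n` on a boundary face. -/
def jump (v : M.DG) (F : M.Face) (x : Euc d) : Euc d :=
  if M.IsInterior F then
    v (L.plus F) x • M.normal (L.plus F) F + v (L.minus F) x • M.normal (L.minus F) F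
  else v (L.plus F) x • M.normal (L.plus F) F

open Classical in
/-- The weighted average of the flux: `β_F (κ ∇v)⁺ + (1 - β_F) (κ ∇v)⁻` on an interior face,
`κ ∇v` on a boundary face. -/
def avgFlux (v : M.DG) (F : M.Face) (x : Euc d) : Euc d :=
  if M.IsInterior F then
    L.beta κ F • κ (L.plus F) • gradient (v (L.plus F)) x +
      (1 - L.beta κ F) • κ (L.minus F) • gradient (v (L.minus F)) x
  else κ (L.plus F) • gradient (v (L.plus F)) x

/-- The weighted average of `v` with the complementary weight `1 - β_F`, on interior faces. -/
def avgCompl (v : M.DG) (F : M.Face) (x : Euc d) : ℝ :=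
  (1 - L.beta κ F) * v (L.plus F) x + L.beta κ F * v (L.minus F) x

/-- The bilinear form of the IP(β)-0 method with parameter `θ`, penalty parameter `α` and
face sizes of kind `s`. -/
def formA0 (s : SizeKind) (θ α : ℝ) (v w : M.DG) : ℝ :=
  (∑ T : M.Cell, ∫ x in hull T.1, κ T * inner ℝ (gradient (v T) x) (gradient (w T) x))
  - (∑ F : M.Face, M.faceInt F fun x => inner ℝ (L.avgFlux κ v F x) (L.jump w F x))
  + θ * (∑ F : M.Face, M.faceInt F fun x => inner ℝ (L.jump v F x) (L.avgFlux κ w F x))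
  + ∑ F : M.Face, M.faceInt F fun x =>
      α * (M.faceSize s F)⁻¹ * L.kappaFace κ F *
        inner ℝ (M.proj0 F (L.jump v F)) (L.jump w F x)

/-- The space `Z_β`. -/
def spaceZ : Set M.DG :=
  {z | ∀ F : M.Face, M.IsInterior F → M.proj0 F (L.avgCompl κ z F) = 0}

open Classical in
/-- The basis function `ψ_F^z` of `Z_β`. -/
def psi (F : M.Face) : M.DG :=
  if M.IsInterior F then
    L.beta κ F • M.crBasis F (L.plus F) - (1 - L.beta κ F) • M.crBasis F (L.minus F)
  else M.crBasis F (L.plus F)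

/-- The diagonal entries `|F| / h_F * κ_F` of the weighted inner product `(·,·)_*`. -/
def starWeight (s : SizeKind) (F : M.Face) : ℝ := M.area F / M.faceSize s F * L.kappaFace κ F

/-- The weighted inner product `(z,φ)_*` of `z = ∑ a_F ψ_F^z` and `φ = ∑ b_F ψ_F^z`. -/
def starInner (s : SizeKind) (a b : M.Face → ℝ) : ℝ :=
  ∑ F : M.Face, L.starWeight κ s F * a F * b F

/-- The block of the stiffness matrix belonging to `Z_β` in the basis `ψ_F^z`. -/
def matrixZZ (s : SizeKind) (θ α : ℝ) : Matrix M.Face M.Face ℝ :=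
  Matrix.of fun F G => L.formA0 κ s θ α (L.psi κ G) (L.psi κ F)

end Labelling

open Classical in
theorem oppCoord_eq (T : M.Cell) (F : M.Face) (v : T.1) (hv : v.1 ∉ F.1)
    (hF : F.1 ⊆ T.1) : M.oppCoord T F = (M.cellBasis T).coord v := by
  have hc : (T.1 \ F.1).card = 1 := by
    have hFc : F.1.card = d := by
      have := F.2
      simp only [faces, Finset.mem_biUnion, Finset.mem_powersetCard] at this
      obtain ⟨_, _, _, h⟩ := this
      exact h
    rw [Finset.card_sdiff_of_subset hF, M.card_cell T.1 T.2, hFc]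
    omega
  obtain ⟨a, ha⟩ := Finset.card_eq_one.mp hc
  have hva : v.1 = a := by
    have : v.1 ∈ T.1 \ F.1 := by simp [hv]
    simpa [ha] using this
  unfold oppCoord
  rw [Finset.sum_eq_single v]
  · simp [hv]
  · intro b _ hb
    rw [if_pos]
    by_contra hbF
    have : b.1 ∈ T.1 \ F.1 := by simp [hbF]
    rw [ha, Finset.mem_singleton] at this
    exact hb (Subtype.ext (this.trans hva.symm))
  · simp

theorem card_face (F : M.Face) : F.1.card = d := by
  have := F.2
  simp only [faces, Finset.mem_biUnion, Finset.mem_powersetCard] at this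
  obtain ⟨_, _, _, h⟩ := this
  exact h

theorem exists_opposite (T : M.Cell) (F : M.Face) (_hF : F.1 ⊆ T.1) : ∃ v : T.1, v.1 ∉ F.1 := by
  by_contra! h
  have h1 : T.1 ⊆ F.1 := fun x hx => h ⟨x, hx⟩
  have h2 := Finset.card_le_card h1
  rw [M.card_face F, M.card_cell T.1 T.2] at h2
  omega

theorem oppCoord_vertex (T : M.Cell) (F : M.Face) (hF : F.1 ⊆ T.1) (w : T.1) :
    (w.1 ∈ F.1 → M.oppCoord T F w = 0) ∧ (w.1 ∉ F.1 → M.oppCoord T F w = 1) := by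
  obtain ⟨v, hv⟩ := M.exists_opposite T F hF
  have hw : (w : Euc d) = M.cellBasis T w := rfl
  constructor
  · intro h
    rw [M.oppCoord_eq T F v hv hF, hw, AffineBasis.coord_apply_ne]
    rintro rfl
    exact hv h
  · intro h
    rw [M.oppCoord_eq T F w h hF, hw, AffineBasis.coord_apply_eq]

open Classical in
/-- The defining property of the canonical Crouzeix-Raviart functions. -/
theorem crBasis_massCenter (hd : 0 < d) (T : M.Cell) (F F' : M.Face) (hF : F.1 ⊆ T.1)
    (hF' : F'.1 ⊆ T.1) :
    M.crBasis F T T (M.massCenter F') = if F' = F then 1 else 0 := by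
  have hd0 : (d : ℝ) ≠ 0 := by positivity
  have key : M.oppCoord T F (M.massCenter F') = (d : ℝ)⁻¹ * ∑ w ∈ F'.1, M.oppCoord T F w := by
    have h1 : ∑ i ∈ F'.1, F'.1.centroidWeights ℝ i = 1 := by
      apply Finset.sum_centroidWeights_eq_one_of_card_ne_zero
      rw [M.card_face]
      omega
    unfold massCenter
    rw [Finset.centroid_def, Finset.map_affineCombination _ _ _ h1,
      Finset.affineCombination_eq_linear_combination _ _ _ h1, Finset.mul_sum]
    apply Finset.sum_congr rfl
    intro w _
    simp [M.card_face]
  have hcr : M.crBasis F T T (M.massCenter F') = 1 - d * M.oppCoord T F (M.massCenter F') := by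
    simp [crBasis]
  rw [hcr, key]
  split_ifs with h
  · subst h
    rw [Finset.sum_eq_zero]
    · simp
    · intro w hw
      exact (M.oppCoord_vertex T F' hF ⟨w, hF hw⟩).1 hw
  · obtain ⟨v, hv⟩ := M.exists_opposite T F hF
    have hnot : ¬ F'.1 ⊆ F.1 := by
      intro hs
      apply h
      apply Subtype.ext
      exact Finset.eq_of_subset_of_card_le hs (by simp [M.card_face])
    obtain ⟨w, hw, hwF⟩ := Finset.not_subset.mp hnot
    have hsub : ∀ u ∈ F'.1, u ∉ F.1 → u = w := by
      intro u hu huF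
      have e1 := M.oppCoord_eq T F ⟨u, hF' hu⟩ huF hF
      have e2 := (M.oppCoord_vertex T F hF ⟨w, hF' hw⟩).2 hwF
      by_contra hne
      rw [e1] at e2
      have hb : w = M.cellBasis T ⟨w, hF' hw⟩ := rfl
      simp only [] at e2
      rw [hb, AffineBasis.coord_apply_ne] at e2
      · exact zero_ne_one e2
      · intro hh
        exact hne (congrArg Subtype.val hh)
    rw [Finset.sum_eq_single w]
    · rw [(M.oppCoord_vertex T F hF ⟨w, hF' hw⟩).2 hwF]
      field_simp
      simp
    · intro u hu hne
      by_cases huF : u ∈ F.1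
      · exact (M.oppCoord_vertex T F hF ⟨u, hF' hu⟩).1 huF
      · exact absurd (hsub u hu huF) hne
    · intro hh
      exact absurd hw hh

theorem inner_gradient_oppCoord (T : M.Cell) (F : M.Face) (x y : Euc d) :
    inner ℝ (gradient (M.oppCoord T F) 0) (x - y) = M.oppCoord T F x - M.oppCoord T F y := by
  have h : HasFDerivAt (M.oppCoord T F)
      (LinearMap.toContinuousLinearMap (M.oppCoord T F).linear) 0 := by
    have e : (M.oppCoord T F : Euc d → ℝ) =
        fun x => LinearMap.toContinuousLinearMap (M.oppCoord T F).linear x + M.oppCoord T F 0 := by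
      funext x
      have := (M.oppCoord T F).map_vadd 0 x
      simpa using this
    rw [e]
    exact (ContinuousLinearMap.hasFDerivAt _).add_const _
  rw [gradient, InnerProductSpace.toDual_symm_apply, h.fderiv]
  have := (M.oppCoord T F).linearMap_vsub x y
  simpa using this

/-- `normal T F` is the outward unit normal: it has norm one, is orthogonal to `F`, and points
away from the vertex opposite to `F`. -/
theorem normal_spec (hd : 0 < d) (T : M.Cell) (F : M.Face) (hF : F.1 ⊆ T.1) :
    ‖M.normal T F‖ = 1 ∧ (∀ x ∈ F.1, ∀ y ∈ F.1, inner ℝ (M.normal T F) (x - y) = 0) ∧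
      ∀ v ∈ T.1, v ∉ F.1 → ∀ y ∈ F.1, inner ℝ (M.normal T F) (v - y) < 0 := by
  obtain ⟨v, hv⟩ := M.exists_opposite T F hF
  obtain ⟨y, hy⟩ : F.1.Nonempty := by
    rw [← Finset.card_pos, M.card_face]
    exact hd
  have hin : ∀ v ∈ T.1, v ∉ F.1 → ∀ y ∈ F.1,
      inner ℝ (gradient (M.oppCoord T F) 0) (v - y) = 1 := by
    intro v hvT hvF y hy
    rw [M.inner_gradient_oppCoord, (M.oppCoord_vertex T F hF ⟨v, hvT⟩).2 hvF,
      (M.oppCoord_vertex T F hF ⟨y, hF hy⟩).1 hy, sub_zero]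
  have hg : gradient (M.oppCoord T F) 0 ≠ 0 := by
    intro h0
    have := hin v v.2 hv y hy
    rw [h0, inner_zero_left] at this
    exact zero_ne_one this
  have hpos : 0 < ‖gradient (M.oppCoord T F) 0‖⁻¹ := inv_pos.mpr (norm_pos_iff.mpr hg)
  refine ⟨?_, ?_, ?_⟩
  · rw [normal, norm_neg, norm_smul, norm_inv, norm_norm, inv_mul_cancel₀ (norm_ne_zero_iff.mpr hg)]
  · intro x hx y hy
    rw [normal, inner_neg_left, real_inner_smul_left, M.inner_gradient_oppCoord,
      (M.oppCoord_vertex T F hF ⟨x, hF hx⟩).1 hx, (M.oppCoord_vertex T F hF ⟨y, hF hy⟩).1 hy]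
    simp
  · intro v hvT hvF y hy
    rw [normal, inner_neg_left, real_inner_smul_left, hin v hvT hvF y hy]
    linarith

end SimplicialMesh

/-- The state of the conjugate gradient iteration: iterate, residual, search direction. -/
structure PCGState (ι : Type) where
  x : ι → ℝ
  r : ι → ℝ
  p : ι → ℝ

/-- Start of the preconditioned conjugate gradient method for `A x = b` with the diagonal
preconditioner `D`. -/
def pcgInit {ι : Type} [Fintype ι] (A : Matrix ι ι ℝ) (D b x₀ : ι → ℝ) : PCGState ι :=
  ⟨x₀, b - A *ᵥ x₀, (b - A *ᵥ x₀) / D⟩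

/-- One step of the preconditioned conjugate gradient method; `r / D` is the residual divided
entrywise by the diagonal.  If the residual is zero, all later iterates stay the same. -/
def pcgStep {ι : Type} [Fintype ι] (A : Matrix ι ι ℝ) (D : ι → ℝ) (s : PCGState ι) : PCGState ι :=
  let a : ℝ := (s.r ⬝ᵥ (s.r / D)) / (s.p ⬝ᵥ (A *ᵥ s.p))
  let r' : ι → ℝ := s.r - a • (A *ᵥ s.p)
  let c : ℝ := (r' ⬝ᵥ (r' / D)) / (s.r ⬝ᵥ (s.r / D))
  ⟨s.x + a • s.p, r', r' / D + c • s.p⟩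

/-- The `k`-th iterate of the preconditioned conjugate gradient method. -/
def pcgIterate {ι : Type} [Fintype ι] (A : Matrix ι ι ℝ) (D b x₀ : ι → ℝ) (k : ℕ) : ι → ℝ :=
  ((pcgStep A D)^[k] (pcgInit A D b x₀)).x

/-- The energy norm `√(xᵀ A x)` of a positive definite matrix. -/
def energyNorm {ι : Type} [Fintype ι] (A : Matrix ι ι ℝ) (x : ι → ℝ) : ℝ := √(x ⬝ᵥ (A *ᵥ x))

end

/-! On `Z_β` the form collapses. The coefficient `z_e` is the mean jump of `z` over `e` along the
normal of the plus side, while the complementary average of `z` has mean zero on interior faces.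
Fluxes of piecewise affine functions are constant on each face, so elementwise integration by parts
against `w ∈ Z_β` leaves only the pairing of the averaged flux of `v` with the jump of `w`
(`stiffness_combine_right`). The consistency term therefore cancels the volume term, and on `Z_β`
the form is `θ a(v,w) + α (v,w)_*`, where `a` is the volume form (`formA0_combine`). This is
symmetric for every `θ`.

What remains is `0 ≤ a(z,z) ≤ C₀ (z,z)_*` (`stiffness_combine_le`). The Crouzeix-Raviart functions
have gradients `-d ∇λ`, with `λ` the barycentric coordinate opposite to the face. The cone formula
`|e| = d |T| |∇λ|` absorbs one power of `|∇λ|`, and shape regularity bounds `h_e |∇λ|`. Robustness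
in `κ` comes from `κ⁺ β² + κ⁻ (1-β)² = κ_e / 2`. The threshold `α ≥ C₀ + 1` then gives coercivity
also for `θ = -1`.

For CG no Chebyshev estimate is needed: a step decreases the energy at least as much as
preconditioned steepest descent is guaranteed to, so spectral equivalence with constants `c, C`
reduces the squared energy error by the factor `1 - c/C` (`PCGInvariant.energy_step`). The diagonal
of the matrix is itself equivalent to the weights `|e| κ_e / h_e`. -/

/-! ### Gradients of affine functions -/

section AffineGradient

theorem AffineMap.finset_sum_apply {ι E V : Type*} [AddCommGroup E] [Module ℝ E] [AddCommGroup V]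
    [Module ℝ V] (s : Finset ι) (f : ι → (E →ᵃ[ℝ] V)) (x : E) :
    (∑ i ∈ s, f i) x = ∑ i ∈ s, f i x :=
  map_sum (⟨⟨fun f : E →ᵃ[ℝ] V => f x, rfl⟩, fun _ _ => rfl⟩ : (E →ᵃ[ℝ] V) →+ V) _ _

variable {E : Type*} [NormedAddCommGroup E] [InnerProductSpace ℝ E] [FiniteDimensional ℝ E]

theorem AffineMap.hasFDerivAt_linear {E F : Type*} [NormedAddCommGroup E] [NormedSpace ℝ E]
    [FiniteDimensional ℝ E] [NormedAddCommGroup F] [NormedSpace ℝ F] (f : E →ᵃ[ℝ] F) (z : E) :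
    HasFDerivAt f (LinearMap.toContinuousLinearMap f.linear) z := by
  have e : (f : E → F) = fun x => LinearMap.toContinuousLinearMap f.linear x + f 0 := by
    funext x
    have := f.map_vadd 0 x
    simpa using this
  rw [e]
  exact (ContinuousLinearMap.hasFDerivAt _).add_const _

theorem AffineMap.inner_gradient_sub (f : E →ᵃ[ℝ] ℝ) (z x y : E) :
    inner ℝ (gradient f z) (x - y) = f x - f y := by
  rw [gradient, InnerProductSpace.toDual_symm_apply, (f.hasFDerivAt_linear z).fderiv]
  have := f.linearMap_vsub x y
  simpa using this

theorem AffineMap.gradient_eq_of_linear (f : E →ᵃ[ℝ] ℝ) (z g : E)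
    (h : ∀ x, inner ℝ g x = f.linear x) : gradient f z = g := by
  apply ext_inner_right ℝ
  intro x
  rw [h]
  have := f.inner_gradient_sub z x 0
  have h2 := f.linearMap_vsub x 0
  simp only [vsub_eq_sub, sub_zero] at this h2
  rw [this, h2]

/-- The gradient of an affine function, as a linear function of it. -/
noncomputable def AffineMap.gradLinear : (E →ᵃ[ℝ] ℝ) →ₗ[ℝ] E where
  toFun f := gradient f 0
  map_add' f g := by
    apply AffineMap.gradient_eq_of_linear
    intro x
    have h1 := f.inner_gradient_sub 0 x 0
    have h2 := g.inner_gradient_sub 0 x 0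
    have h3 := (f + g).linearMap_vsub x 0
    simp only [vsub_eq_sub, sub_zero] at h1 h2 h3
    rw [inner_add_left, h1, h2, h3]
    simp only [AffineMap.coe_add, Pi.add_apply]
    ring
  map_smul' c f := by
    apply AffineMap.gradient_eq_of_linear
    intro x
    have h1 := f.inner_gradient_sub 0 x 0
    have h3 := (c • f).linearMap_vsub x 0
    simp only [vsub_eq_sub, sub_zero] at h1 h3
    rw [RingHom.id_apply, real_inner_smul_left, h1, h3]
    simp only [AffineMap.coe_smul, Pi.smul_apply, smul_eq_mul]
    ring

theorem AffineMap.gradient_eq_gradLinear (f : E →ᵃ[ℝ] ℝ) (z : E) :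
    gradient f z = AffineMap.gradLinear f := by
  apply ext_inner_right ℝ
  intro x
  have h1 := f.inner_gradient_sub z x 0
  have h2 := f.inner_gradient_sub 0 x 0
  simp only [sub_zero] at h1 h2
  rw [h1, AffineMap.gradLinear]
  exact h2.symm

theorem AffineMap.gradLinear_const (c : ℝ) : AffineMap.gradLinear (AffineMap.const ℝ E c) = 0 := by
  apply AffineMap.gradient_eq_of_linear
  simp

end AffineGradient

/-! ### Integrals of affine functions over a simplex -/

section Barycenter

variable {E : Type*} [NormedAddCommGroup E] [NormedSpace ℝ E] [FiniteDimensional ℝ E]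
  [MeasurableSpace E] [BorelSpace E]
variable {ι : Type*} [Fintype ι]

omit [MeasurableSpace E] [BorelSpace E] [FiniteDimensional ℝ E] in
theorem AffineBasis.map_eq_sum_coord {F : Type*} [AddCommGroup F] [Module ℝ F]
    (b : AffineBasis ι ℝ E) (f : E →ᵃ[ℝ] F) (x : E) : f x = ∑ k, b.coord k x • f (b k) := by
  have h1 := b.sum_coord_apply_eq_one x
  conv_lhs => rw [← b.affineCombination_coord_eq_self x]
  rw [Finset.map_affineCombination _ _ _ h1,
    Finset.affineCombination_eq_linear_combination _ _ _ h1]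
  rfl

omit [MeasurableSpace E] [BorelSpace E] [FiniteDimensional ℝ E] in
theorem AffineBasis.isCompact_convexHull_range (b : AffineBasis ι ℝ E) :
    IsCompact (convexHull ℝ (Set.range b)) :=
  (Set.finite_range b).isCompact_convexHull (𝕜 := ℝ)

omit [BorelSpace E] [FiniteDimensional ℝ E] in
theorem AffineBasis.measure_convexHull_pos (b : AffineBasis ι ℝ E) (μ : Measure E)
    [μ.IsAddHaarMeasure] : 0 < μ (convexHull ℝ (Set.range b)) := by
  have h : (interior (convexHull ℝ (Set.range b))).Nonempty :=
    ⟨_, b.centroid_mem_interior_convexHull⟩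
  exact (isOpen_interior.measure_pos μ h).trans_le (measure_mono interior_subset)

/-- The barycentric coordinates of a simplex have the same integral over it. -/
theorem AffineBasis.setIntegral_coord_eq (b : AffineBasis ι ℝ E) (μ : Measure E)
    [μ.IsAddHaarMeasure] (i j : ι) :
    ∫ x in convexHull ℝ (Set.range b), b.coord i x ∂μ =
      ∫ x in convexHull ℝ (Set.range b), b.coord j x ∂μ := by
  classical
  rcases eq_or_ne i j with rfl | hij
  · rfl
  set S := convexHull ℝ (Set.range b) with hS
  have hSmem : ∀ x, x ∈ S ↔ ∀ k, 0 ≤ b.coord k x := fun x => by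
    rw [hS, b.convexHull_eq_nonneg_coord]; rfl
  -- The affine involution that exchanges the vertices `b i` and `b j`: it swaps the two barycentric
  -- coordinates and maps the simplex onto itself.
  let e : E → E := fun x => x + (b.coord j x - b.coord i x) • (b i - b j)
  have hc : ∀ k x, b.coord k (e x) =
      b.coord k x + (b.coord j x - b.coord i x) * (b.coord k (b i) - b.coord k (b j)) := by
    intro k x
    have h1 := (b.coord k).map_vadd x ((b.coord j x - b.coord i x) • (b i - b j))
    have h2 := (b.coord k).linearMap_vsub (b i) (b j)
    simp only [vadd_eq_add, map_smul, smul_eq_mul, vsub_eq_sub] at h1 h2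
    rw [h2] at h1
    rw [← add_comm, h1.symm, add_comm]
  have hce : ∀ k x, b.coord k (e x) = b.coord (Equiv.swap i j k) x := by
    intro k x
    rw [hc, b.coord_apply, b.coord_apply]
    by_cases hki : k = i
    · subst hki; simp [hij]
    · by_cases hkj : k = j
      · subst hkj; simp [hki]
      · simp [hki, hkj, Equiv.swap_apply_of_ne_of_ne hki hkj]
  have hee : ∀ x, e (e x) = x := fun x => b.ext_elem fun k => by simp [hce]
  have himg : e '' S = S := by
    apply Set.Subset.antisymm
    · rintro _ ⟨x, hx, rfl⟩
      rw [hSmem] at hx ⊢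
      exact fun k => by rw [hce]; exact hx _
    · intro x hx
      refine ⟨e x, ?_, hee x⟩
      rw [hSmem] at hx ⊢
      exact fun k => by rw [hce]; exact hx _
  have hinj : Function.Injective e := (Function.LeftInverse.injective hee)
  obtain ⟨A, hA⟩ : ∃ A : E →L[ℝ] E, ∀ x, HasFDerivAt e A x := by
    exact ⟨_, fun x => (hasFDerivAt_id x).add
      ((((b.coord j).hasFDerivAt_linear x).sub ((b.coord i).hasFDerivAt_linear x)).smul_const _)⟩
  have hSm : MeasurableSet S := b.isCompact_convexHull_range.isClosed.measurableSet
  have key : ∀ g : E → ℝ, ∫ x in S, g x ∂μ = |A.det| * ∫ x in S, g (e x) ∂μ := by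
    intro g
    have := integral_image_eq_integral_abs_det_fderiv_smul μ hSm
      (fun x _ => (hA x).hasFDerivWithinAt) hinj.injOn g
    rw [himg] at this
    rw [this, ← integral_const_mul]
    rfl
  have hpos : 0 < μ.real S :=
    ENNReal.toReal_pos (b.measure_convexHull_pos μ).ne' b.isCompact_convexHull_range.measure_lt_top.ne
  -- The determinant need not be computed: `g = 1` in the change of variables gives it, because the
  -- simplex has positive finite volume.
  have hdet : |A.det| = 1 := by
    have := key fun _ => 1
    simp only [integral_const, MeasurableSet.univ, measureReal_restrict_apply, Set.univ_inter,
      smul_eq_mul, mul_one] at this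
    exact (mul_right_cancel₀ hpos.ne' (by linarith : |A.det| * μ.real S = 1 * μ.real S))
  rw [key, hdet, one_mul]
  simp [hce]

/-- The integral of an affine function over a simplex is the volume times the mean value of the
vertex values. -/
theorem AffineBasis.setIntegral_affineMap (b : AffineBasis ι ℝ E) (μ : Measure E)
    [μ.IsAddHaarMeasure] {V : Type*} [NormedAddCommGroup V] [NormedSpace ℝ V] [CompleteSpace V]
    (f : E →ᵃ[ℝ] V) :
    ∫ x in convexHull ℝ (Set.range b), f x ∂μ =
      μ.real (convexHull ℝ (Set.range b)) • (Fintype.card ι : ℝ)⁻¹ • ∑ k, f (b k) := by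
  have hcomp := b.isCompact_convexHull_range
  have hint : ∀ k, IntegrableOn (b.coord k) (convexHull ℝ (Set.range b)) μ := fun k =>
    (continuous_barycentric_coord b k).continuousOn.integrableOn_compact hcomp
  obtain ⟨i⟩ := b.nonempty
  have hcard : (Fintype.card ι : ℝ) ≠ 0 := by
    have : Nonempty ι := ⟨i⟩
    exact_mod_cast Fintype.card_ne_zero
  have hone : ∀ k, ∫ x in convexHull ℝ (Set.range b), b.coord k x ∂μ =
      (Fintype.card ι : ℝ)⁻¹ * μ.real (convexHull ℝ (Set.range b)) := by
    intro k
    have h1 : ∑ l, ∫ x in convexHull ℝ (Set.range b), b.coord l x ∂μ =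
        μ.real (convexHull ℝ (Set.range b)) := by
      rw [← integral_finsetSum _ fun l _ => hint l]
      simp
    rw [Finset.sum_congr rfl fun l _ => b.setIntegral_coord_eq μ l k] at h1
    simp only [Finset.sum_const, Finset.card_univ, nsmul_eq_mul] at h1
    rw [← h1, inv_mul_cancel_left₀ hcard]
  have hf : ∀ x, f x = ∑ k, b.coord k x • f (b k) := b.map_eq_sum_coord f
  rw [integral_congr_ae (Filter.Eventually.of_forall hf),
    integral_finsetSum _ fun l _ => (hint l).smul_const _]
  simp only [integral_smul_const]
  simp only [hone, Finset.smul_sum, smul_smul, mul_comm]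

end Barycenter

/-! ### Surface measure and surface integrals on faces -/

section FaceMeasure

variable {m : ℕ} (F : Finset (Euc (m + 1)))

/-- A nondegenerate `m`-simplex in `ℝ^(m+1)` is an isometric copy of a simplex in `ℝ^m`. -/
theorem exists_isometric_affineBasis (hF : F.card = m + 1)
    (hind : AffineIndependent ℝ ((↑) : F → Euc (m + 1))) :
    ∃ (b : AffineBasis F ℝ (Euc m)) (f : Euc m →ᵃⁱ[ℝ] Euc (m + 1)), ∀ v, f (b v) = v := by
  obtain ⟨p, hp⟩ : F.Nonempty := by rw [← Finset.card_pos]; omega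
  have hcard : Fintype.card F = m + 1 := by simp [hF]
  have hrank : Module.finrank ℝ (vectorSpan ℝ (Set.range ((↑) : F → Euc (m + 1)))) = m :=
    hind.finrank_vectorSpan hcard
  set W := vectorSpan ℝ (Set.range ((↑) : F → Euc (m + 1))) with hW
  let o : W ≃ₗᵢ[ℝ] Euc m := ((stdOrthonormalBasis ℝ W).reindex (finCongr hrank)).repr
  let f : Euc m →ᵃⁱ[ℝ] Euc (m + 1) :=
    (AffineIsometryEquiv.vaddConst ℝ p).toAffineIsometry.comp
      (W.subtypeₗᵢ.comp o.symm.toLinearIsometry).toAffineIsometry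
  let q : F → Euc m := fun v => o ⟨v.1 - p, vsub_mem_vectorSpan ℝ ⟨v, rfl⟩ ⟨⟨p, hp⟩, rfl⟩⟩
  have hfq : ∀ v, f (q v) = v := by
    intro v
    simp [f, q]
  have hq : AffineIndependent ℝ q := by
    apply AffineIndependent.of_comp f.toAffineMap
    have h : f.toAffineMap ∘ q = ((↑) : F → Euc (m + 1)) := funext hfq
    rw [h]
    exact hind
  exact ⟨⟨q, hq, by
    rw [hq.affineSpan_eq_top_iff_card_eq_finrank_add_one, hcard]; simp⟩, f, hfq⟩

theorem hull_eq_image {b : AffineBasis F ℝ (Euc m)} {f : Euc m →ᵃⁱ[ℝ] Euc (m + 1)}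
    (hfb : ∀ v, f (b v) = v) :
    convexHull ℝ (F : Set (Euc (m + 1))) = f '' convexHull ℝ (Set.range b) := by
  have := f.toAffineMap.image_convexHull (Set.range b)
  rw [← Set.range_comp] at this
  have h2 : f.toAffineMap ∘ b = ((↑) : F → Euc (m + 1)) := funext hfb
  rw [h2] at this
  have h3 : Set.range ((↑) : F → Euc (m + 1)) = (F : Set (Euc (m + 1))) := by simp
  rw [h3] at this
  exact this.symm

theorem measureHE_image_isometry (f : Euc m →ᵃⁱ[ℝ] Euc (m + 1)) (s : Set (Euc m)) :
    (μHE[m] : Measure (Euc (m + 1))) (f '' s) = volume s := by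
  rw [f.isometry.euclideanHausdorffMeasure_image, EuclideanSpace.euclideanHausdorffMeasure_eq_volume]

theorem setIntegral_image_isometry {V : Type*} [NormedAddCommGroup V] [NormedSpace ℝ V]
    (f : Euc m →ᵃⁱ[ℝ] Euc (m + 1)) (s : Set (Euc m)) (g : Euc (m + 1) → V) :
    ∫ x in f '' s, g x ∂(μHE[m] : Measure (Euc (m + 1))) = ∫ y in s, g (f y) := by
  have hemb : MeasurableEmbedding f := f.isometry.isClosedEmbedding.measurableEmbedding
  have hmap : (volume : Measure (Euc m)).map f =
      (μHE[m] : Measure (Euc (m + 1))).restrict (Set.range f) := by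
    rw [← f.isometry.map_euclideanHausdorffMeasure,
      EuclideanSpace.euclideanHausdorffMeasure_eq_volume]
  have h1 := hemb.setIntegral_map (μ := volume) g (f '' s)
  rw [hmap, Measure.restrict_restrict_of_subset (Set.image_subset_range _ _),
    Set.preimage_image_eq _ hemb.injective] at h1
  exact h1

theorem measureHE_hull_pos (hF : F.card = m + 1)
    (hind : AffineIndependent ℝ ((↑) : F → Euc (m + 1))) :
    0 < (μHE[m] : Measure (Euc (m + 1))).real (convexHull ℝ (F : Set (Euc (m + 1)))) := by
  obtain ⟨b, f, hfb⟩ := exists_isometric_affineBasis F hF hind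
  rw [Measure.real, hull_eq_image F hfb, measureHE_image_isometry]
  exact ENNReal.toReal_pos (b.measure_convexHull_pos volume).ne'
    b.isCompact_convexHull_range.measure_lt_top.ne

/-- The midpoint rule, exact for affine integrands: in isometric coordinates the integral is the
measure times the mean of the vertex values, and this mean is the value at the centroid. -/
theorem setIntegral_hull_affineMap (hF : F.card = m + 1)
    (hind : AffineIndependent ℝ ((↑) : F → Euc (m + 1)))
    {V : Type*} [NormedAddCommGroup V] [NormedSpace ℝ V] [CompleteSpace V]
    (g : Euc (m + 1) →ᵃ[ℝ] V) :
    ∫ x in convexHull ℝ (F : Set (Euc (m + 1))), g x ∂(μHE[m] : Measure (Euc (m + 1))) =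
      (μHE[m] : Measure (Euc (m + 1))).real (convexHull ℝ (F : Set (Euc (m + 1)))) •
        g (F.centroid ℝ id) := by
  obtain ⟨b, f, hfb⟩ := exists_isometric_affineBasis F hF hind
  have hcen : g (F.centroid ℝ id) = ((m : ℝ) + 1)⁻¹ • ∑ v ∈ F, g v := by
    have h1 : ∑ i ∈ F, F.centroidWeights ℝ i = 1 := by
      apply Finset.sum_centroidWeights_eq_one_of_card_ne_zero
      omega
    rw [Finset.centroid_def, Finset.map_affineCombination _ _ _ h1,
      Finset.affineCombination_eq_linear_combination _ _ _ h1, Finset.smul_sum]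
    simp [hF]
  have h2 := b.setIntegral_affineMap volume (g.comp f.toAffineMap)
  have h3 : ∑ k, (g.comp f.toAffineMap) (b k) = ∑ v ∈ F, g v := by
    rw [← Finset.sum_coe_sort F]
    refine Finset.sum_congr rfl fun k _ => ?_
    change g (f (b k)) = _
    rw [hfb]
  rw [h3] at h2
  rw [Measure.real, hull_eq_image F hfb, measureHE_image_isometry, setIntegral_image_isometry,
    hcen]
  simpa [hF, Measure.real] using h2

/-- In isometric coordinates the simplex lies in the ball about one of its vertices whose radius is
its diameter. -/
theorem measureHE_hull_le (hF : F.card = m + 1)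
    (hind : AffineIndependent ℝ ((↑) : F → Euc (m + 1))) :
    (μHE[m] : Measure (Euc (m + 1))).real (convexHull ℝ (F : Set (Euc (m + 1)))) ≤
      (volume : Measure (Euc m)).real (Metric.closedBall 0 1) *
        Metric.diam (convexHull ℝ (F : Set (Euc (m + 1)))) ^ m := by
  obtain ⟨b, f, hfb⟩ := exists_isometric_affineBasis F hF hind
  rw [Measure.real, hull_eq_image F hfb, measureHE_image_isometry, f.isometry.diam_image]
  set S := convexHull ℝ (Set.range b) with hS
  obtain ⟨i⟩ := b.nonempty
  have hi : b i ∈ S := subset_convexHull ℝ _ ⟨i, rfl⟩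
  have hsub : S ⊆ Metric.closedBall (b i) (Metric.diam S) := fun x hx =>
    Metric.dist_le_diam_of_mem b.isCompact_convexHull_range.isBounded hx hi
  have h1 : volume.real S ≤ volume.real (Metric.closedBall (b i) (Metric.diam S)) :=
    measureReal_mono hsub (measure_closedBall_lt_top).ne
  refine h1.trans_eq ?_
  rw [Measure.real, Measure.addHaar_closedBall' _ _ Metric.diam_nonneg, ENNReal.toReal_mul,
    ENNReal.toReal_ofReal (by positivity), mul_comm]
  simp [Measure.real]

end FaceMeasure

/-! ### Volume of a cone by slicing -/

section Cone

variable {m : ℕ}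

theorem lintegral_one_sub_pow (m : ℕ) :
    ∫⁻ x in Set.Ico (0 : ℝ) 1, ENNReal.ofReal ((1 - x) ^ m) = ENNReal.ofReal ((m + 1 : ℝ)⁻¹) := by
  rw [← ofReal_integral_eq_lintegral_ofReal]
  · rw [integral_Ico_eq_integral_Ioc, ← intervalIntegral.integral_of_le zero_le_one,
      intervalIntegral.integral_comp_sub_left (fun x => x ^ m) 1]
    simp
  · exact (by fun_prop : Continuous fun x : ℝ => (1 - x) ^ m).continuousOn.integrableOn_Icc.mono_set
      Set.Ico_subset_Icc_self
  · filter_upwards [ae_restrict_mem measurableSet_Ico] with x hx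
    have : 0 ≤ 1 - x := by linarith [hx.2]
    positivity

/-- Volume of a cone over a set `B` in a hyperplane. -/
theorem volume_convexJoin (B : Set (Euc (m + 1))) (hBne : B.Nonempty)
    (a : Euc (m + 1)) (hmeas : MeasurableSet (convexJoin ℝ {a} B))
    (l : Euc (m + 1) →ᵃ[ℝ] ℝ) (ha : l a = 1) (hlB : ∀ x ∈ B, l x = 0) :
    volume (convexJoin ℝ {a} B) =
      ENNReal.ofReal (‖AffineMap.gradLinear l‖⁻¹ * (m + 1 : ℝ)⁻¹) * μHE[m] B := by
  obtain ⟨p, hp⟩ := hBne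
  set g := AffineMap.gradLinear l with hg
  have hin : ∀ x y, inner ℝ g (x - y) = l x - l y := fun x y => by
    rw [hg, ← AffineMap.gradient_eq_gradLinear l 0, AffineMap.inner_gradient_sub]
  have hg0 : g ≠ 0 := by
    intro h
    have := hin a p
    rw [h, inner_zero_left, ha, hlB p hp] at this
    norm_num at this
  have hgn : 0 < ‖g‖ := norm_pos_iff.mpr hg0
  -- Scaled so that moving by `x • v` raises `l` by `x`. The slices orthogonal to `v` are then the
  -- level sets of `l`, and `‖v‖ = ‖g‖⁻¹` is the height of the cone.
  let v : Euc (m + 1) := (‖g‖ ^ 2)⁻¹ • g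
  have hv : v ≠ 0 := smul_ne_zero (by positivity) hg0
  have hvn : ‖v‖ = ‖g‖⁻¹ := by
    rw [norm_smul, norm_inv, norm_pow, norm_norm]
    field_simp
  have hslice : ∀ x : ℝ, (AffineSubspace.mk' (x • v +ᵥ p) (ℝ ∙ v)ᗮ : Set (Euc (m + 1))) =
      {y | l y = x} := by
    intro x
    ext y
    rw [SetLike.mem_coe, AffineSubspace.mem_mk', Submodule.mem_orthogonal_singleton_iff_inner_right]
    have e1 : inner ℝ v (y -ᵥ (x • v +ᵥ p)) = (‖g‖ ^ 2)⁻¹ * (l y - x) := by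
      have : y -ᵥ (x • v +ᵥ p) = (y - p) - x • v := by
        simp only [vsub_eq_sub, vadd_eq_add]; abel
      rw [this, inner_sub_right]
      have h2 : inner ℝ v (x • v) = (‖g‖ ^ 2)⁻¹ * x := by
        rw [real_inner_smul_right, real_inner_self_eq_norm_sq, hvn]
        field_simp
      have h3 : inner ℝ v (y - p) = (‖g‖ ^ 2)⁻¹ * l y := by
        rw [real_inner_smul_left, hin, hlB p hp, sub_zero]
      rw [h2, h3]; ring
    rw [e1]
    simp [hg0, sub_eq_zero]
  have hmem : ∀ y ∈ convexJoin ℝ {a} B, ∃ t ∈ Set.Icc (0 : ℝ) 1, ∃ z ∈ B,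
      y = AffineMap.homothety a (1 - t) z ∧ l y = t := by
    intro y hy
    rw [mem_convexJoin] at hy
    obtain ⟨_, rfl, z, hz, hy⟩ := hy
    rw [segment_eq_image_lineMap] at hy
    obtain ⟨s, hs, rfl⟩ := hy
    refine ⟨1 - s, ⟨by linarith [hs.2], by linarith [hs.1]⟩, z, hz, ?_, ?_⟩
    · rw [AffineMap.homothety_eq_lineMap]; simp
    · rw [AffineMap.apply_lineMap, ha, hlB z hz]
      simp [AffineMap.lineMap_apply]; ring
  have hslice' : ∀ x ∈ Set.Ico (0 : ℝ) 1, convexJoin ℝ {a} B ∩ {y | l y = x} =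
      AffineMap.homothety a (1 - x) '' B := by
    intro x hx
    ext y
    constructor
    · rintro ⟨hy, hyx⟩
      obtain ⟨t, ht, z, hz, rfl, hl⟩ := hmem y hy
      have : t = x := hl.symm.trans hyx
      subst this
      exact ⟨z, hz, rfl⟩
    · rintro ⟨z, hz, rfl⟩
      refine ⟨?_, ?_⟩
      · rw [mem_convexJoin]
        refine ⟨a, rfl, z, hz, ?_⟩
        rw [segment_eq_image_lineMap]
        exact ⟨1 - x, ⟨by linarith [hx.2], by linarith [hx.1]⟩, by
          rw [AffineMap.homothety_eq_lineMap]⟩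
      · change l _ = x
        rw [AffineMap.homothety_eq_lineMap, AffineMap.apply_lineMap, ha, hlB z hz]
        simp [AffineMap.lineMap_apply]
  have hempty : ∀ x, x ∉ Set.Icc (0 : ℝ) 1 → convexJoin ℝ {a} B ∩ {y | l y = x} = ∅ := by
    intro x hx
    ext y
    simp only [Set.mem_inter_iff, Set.mem_ofPred_eq, Set.mem_empty_iff_false, iff_false, not_and]
    intro hy hyx
    obtain ⟨t, ht, z, hz, -, hl⟩ := hmem y hy
    exact hx (by rw [← hyx, hl]; exact ht)
  have hdim : Module.finrank ℝ (Euc (m + 1)) = m + 1 := by simp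
  have hmain := EuclideanGeometry.euclideanHausdorffMeasure_eq_lintegral p hv hmeas
  rw [hdim, Nat.add_sub_cancel, EuclideanSpace.euclideanHausdorffMeasure_eq_volume] at hmain
  simp_rw [hslice] at hmain
  have hae : (fun x : ℝ => (μHE[m] : Measure (Euc (m + 1))) (convexJoin ℝ {a} B ∩ {y | l y = x}))
      =ᵐ[volume] (Set.Ico (0 : ℝ) 1).indicator
        fun x => ENNReal.ofReal ((1 - x) ^ m) * μHE[m] B := by
    -- The level of the apex is discarded: there the homothety ratio `1 - x` is zero and the scaling
    -- rule for the measure does not apply.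
    have h1 : ∀ᵐ x : ℝ, x ≠ 1 := by
      simp [ae_iff]
    filter_upwards [h1] with x hx1
    by_cases hx : x ∈ Set.Ico (0 : ℝ) 1
    · have hpos : 0 < 1 - x := by linarith [hx.2]
      rw [Set.indicator_of_mem hx, hslice' x hx, euclideanHausdorffMeasure_homothety_image _ _ hpos.ne']
      rw [ENNReal.smul_def, smul_eq_mul]
      congr 1
      rw [ENNReal.coe_pow, ENNReal.ofReal_pow hpos.le]
      congr 1
      rw [← Real.enorm_eq_ofReal hpos.le]; rfl
    · rw [Set.indicator_of_notMem hx, hempty, measure_empty]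
      intro h
      exact hx ⟨h.1, lt_of_le_of_ne h.2 hx1⟩
  rw [hmain, lintegral_congr_ae hae, lintegral_indicator measurableSet_Ico,
    lintegral_mul_const _ (by fun_prop), lintegral_one_sub_pow, ← mul_assoc,
    ENNReal.ofReal_mul (by positivity), ← hvn, ofReal_norm]

end Cone

namespace SimplicialMesh

/-! ### Faces of the mesh: midpoint rule, sizes, heights -/

section Faces

variable {m : ℕ} (M : SimplicialMesh (m + 1))

theorem face_exists_cell (F : M.Face) : ∃ T : M.Cell, F.1 ⊆ T.1 := by
  have := F.2
  simp only [faces, Finset.mem_biUnion, Finset.mem_powersetCard] at this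
  obtain ⟨T, hT, h, _⟩ := this
  exact ⟨⟨T, hT⟩, h⟩

theorem face_affineIndependent (F : M.Face) :
    AffineIndependent ℝ ((↑) : F.1 → Euc (m + 1)) := by
  obtain ⟨T, hT⟩ := M.face_exists_cell F
  exact (M.affineIndependent T.1 T.2).mono (Finset.coe_subset.mpr hT)

theorem face_nonempty (F : M.Face) : F.1.Nonempty := by
  rw [← Finset.card_pos, M.card_face]
  omega

theorem area_pos (F : M.Face) : 0 < M.area F :=
  measureHE_hull_pos F.1 (M.card_face F) (M.face_affineIndependent F)

theorem setIntegral_face_affineMap {V : Type*} [NormedAddCommGroup V] [NormedSpace ℝ V]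
    [CompleteSpace V] (F : M.Face) (g : Euc (m + 1) →ᵃ[ℝ] V) :
    ∫ x in hull F.1, g x ∂(μHE[m] : Measure (Euc (m + 1))) = M.area F • g (M.massCenter F) :=
  setIntegral_hull_affineMap F.1 (M.card_face F) (M.face_affineIndependent F) g

theorem faceInt_affineMap (F : M.Face) (g : Euc (m + 1) →ᵃ[ℝ] ℝ) :
    M.faceInt F g = M.area F * g (M.massCenter F) :=
  M.setIntegral_face_affineMap F g

theorem proj0_affineMap {V : Type*} [NormedAddCommGroup V] [NormedSpace ℝ V]
    [CompleteSpace V] (F : M.Face) (g : Euc (m + 1) →ᵃ[ℝ] V) :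
    M.proj0 F g = g (M.massCenter F) := by
  have h := M.setIntegral_face_affineMap F g
  rw [proj0, setAverage_eq]
  have h' : (∫ x in hull F.1, g x ∂(μHE[m + 1 - 1] : Measure (Euc (m + 1)))) =
    M.area F • g (M.massCenter F) := h
  rw [h', smul_smul]
  have : ((μHE[m + 1 - 1] : Measure (Euc (m + 1))).real (hull F.1))⁻¹ * M.area F = 1 :=
    inv_mul_cancel₀ (M.area_pos F).ne'
  rw [this, one_smul]

theorem area_le (F : M.Face) :
    M.area F ≤ (volume : Measure (Euc m)).real (Metric.closedBall 0 1) *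
      Metric.diam (hull F.1) ^ m :=
  measureHE_hull_le F.1 (M.card_face F) (M.face_affineIndependent F)

theorem isBounded_hull (S : Finset (Euc (m + 1))) : Bornology.IsBounded (hull S) :=
  (S.finite_toSet.isCompact_convexHull (𝕜 := ℝ)).isBounded

theorem diam_face_pos (hm : 1 ≤ m) (F : M.Face) : 0 < Metric.diam (hull F.1) := by
  have h1 : 1 < F.1.card := by rw [M.card_face]; omega
  obtain ⟨x, hx, y, hy, hxy⟩ := Finset.one_lt_card.mp h1
  exact (dist_pos.mpr hxy).trans_le (Metric.dist_le_diam_of_mem (isBounded_hull F.1)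
    (subset_convexHull ℝ _ hx) (subset_convexHull ℝ _ hy))

theorem faceSize_pos (hm : 1 ≤ m) (s : SizeKind) (F : M.Face) : 0 < M.faceSize s F := by
  cases s
  · exact M.area_pos F
  · exact M.diam_face_pos hm F

/-- The gradient of the barycentric coordinate of `T` opposite to `F`. -/
noncomputable def oppGrad (T : M.Cell) (F : M.Face) : Euc (m + 1) :=
  AffineMap.gradLinear (M.oppCoord T F)

/-- The volume of a simplex. -/
noncomputable def cellVolume (T : M.Cell) : ℝ := volume.real (hull T.1)

theorem inner_oppGrad_sub (T : M.Cell) (F : M.Face) (x y : Euc (m + 1)) :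
    inner ℝ (M.oppGrad T F) (x - y) = M.oppCoord T F x - M.oppCoord T F y :=
  M.inner_gradient_oppCoord T F x y

theorem normal_eq (T : M.Cell) (F : M.Face) :
    M.normal T F = -(‖M.oppGrad T F‖⁻¹ • M.oppGrad T F) := rfl

theorem oppCoord_eq_zero_of_mem_hull {T : M.Cell} {F : M.Face} (hF : F.1 ⊆ T.1)
    {x : Euc (m + 1)} (hx : x ∈ hull F.1) : M.oppCoord T F x = 0 := by
  have h : hull F.1 ⊆ {x | M.oppCoord T F x = 0} := by
    apply convexHull_min
    · intro v hv
      exact (M.oppCoord_vertex T F hF ⟨v, hF hv⟩).1 hv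
    · exact (convex_singleton (0 : ℝ)).affine_preimage (M.oppCoord T F)
  exact h hx

theorem range_cellBasis (T : M.Cell) : Set.range (M.cellBasis T) = (T.1 : Set (Euc (m + 1))) := by
  ext x
  constructor
  · rintro ⟨v, rfl⟩
    exact v.2
  · intro hx
    exact ⟨⟨x, hx⟩, rfl⟩

theorem mem_hull_cell_iff (T : M.Cell) (x : Euc (m + 1)) :
    x ∈ hull T.1 ↔ ∀ v, 0 ≤ (M.cellBasis T).coord v x := by
  rw [hull, ← range_cellBasis, (M.cellBasis T).convexHull_eq_nonneg_coord]
  rfl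

theorem oppCoord_mem_Icc {T : M.Cell} {F : M.Face} (hF : F.1 ⊆ T.1)
    {x : Euc (m + 1)} (hx : x ∈ hull T.1) : M.oppCoord T F x ∈ Set.Icc (0 : ℝ) 1 := by
  have h : hull T.1 ⊆ {x | M.oppCoord T F x ∈ Set.Icc (0 : ℝ) 1} := by
    apply convexHull_min
    · intro v hv
      by_cases hvF : v ∈ F.1
      · have := (M.oppCoord_vertex T F hF ⟨v, hv⟩).1 hvF
        simp only [Set.mem_ofPred_eq] at *
        rw [this]; simp
      · have := (M.oppCoord_vertex T F hF ⟨v, hv⟩).2 hvF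
        simp only [Set.mem_ofPred_eq] at *
        rw [this]; simp
    · exact (convex_Icc (0 : ℝ) 1).affine_preimage (M.oppCoord T F)
  exact h hx

theorem oppGrad_ne_zero {T : M.Cell} {F : M.Face} (hF : F.1 ⊆ T.1) : M.oppGrad T F ≠ 0 := by
  obtain ⟨v, hv⟩ := M.exists_opposite T F hF
  obtain ⟨y, hy⟩ := M.face_nonempty F
  intro h
  have := M.inner_oppGrad_sub T F v y
  rw [h, inner_zero_left, (M.oppCoord_vertex T F hF v).2 hv,
    (M.oppCoord_vertex T F hF ⟨y, hF hy⟩).1 hy] at this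
  norm_num at this

theorem cell_eq_insert [DecidableEq (Euc (m + 1))] {T : M.Cell} {F : M.Face} (hF : F.1 ⊆ T.1)
    {v : T.1} (hv : v.1 ∉ F.1) : T.1 = insert v.1 F.1 := by
  symm
  apply Finset.eq_of_subset_of_card_le
  · intro x hx
    rcases Finset.mem_insert.mp hx with rfl | hx
    · exact v.2
    · exact hF hx
  · rw [Finset.card_insert_of_notMem hv, M.card_face, M.card_cell T.1 T.2]

/-- The simplex is the cone over `F` with the opposite vertex as apex, and its height is the
reciprocal of the length of the barycentric gradient. -/
theorem area_eq {T : M.Cell} {F : M.Face} (hF : F.1 ⊆ T.1) :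
    M.area F = (m + 1) * M.cellVolume T * ‖M.oppGrad T F‖ := by
  classical
  obtain ⟨v, hv⟩ := M.exists_opposite T F hF
  have hT : hull T.1 = convexJoin ℝ {v.1} (hull F.1) := by
    have h1 : (T.1 : Set (Euc (m + 1))) = insert v.1 (F.1 : Set (Euc (m + 1))) := by
      rw [← Finset.coe_insert, Finset.coe_inj]
      exact M.cell_eq_insert hF hv
    rw [hull, h1, convexHull_insert (by simpa using M.face_nonempty F)]
  have hmeas : MeasurableSet (hull T.1) :=
    (T.1.finite_toSet.isCompact_convexHull (𝕜 := ℝ)).isClosed.measurableSet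
  have hne : (hull F.1).Nonempty := by
    simpa using M.face_nonempty F
  have h := volume_convexJoin (hull F.1) hne v.1 (hT ▸ hmeas) (M.oppCoord T F)
    ((M.oppCoord_vertex T F hF v).2 hv) (fun x hx => M.oppCoord_eq_zero_of_mem_hull hF hx)
  have hpos : 0 < ‖M.oppGrad T F‖ := norm_pos_iff.mpr (M.oppGrad_ne_zero hF)
  have h2 : M.cellVolume T = ‖M.oppGrad T F‖⁻¹ * (m + 1 : ℝ)⁻¹ * M.area F := by
    rw [cellVolume, Measure.real, hT, h, ENNReal.toReal_mul, ENNReal.toReal_ofReal]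
    · rfl
    · have := norm_nonneg (AffineMap.gradLinear (M.oppCoord T F))
      positivity
  rw [h2]
  field_simp

theorem area_smul_normal {T : M.Cell} {F : M.Face} (hF : F.1 ⊆ T.1) :
    M.area F • M.normal T F = -(((m + 1) * M.cellVolume T) • M.oppGrad T F) := by
  have hpos : 0 < ‖M.oppGrad T F‖ := norm_pos_iff.mpr (M.oppGrad_ne_zero hF)
  rw [M.area_eq hF, normal_eq, smul_neg, smul_smul, mul_assoc, mul_inv_cancel₀ hpos.ne', mul_one]

end Faces

/-! ### Crouzeix-Raviart unisolvence and the divergence theorem on a simplex -/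

section Unisolvence

variable {m : ℕ} (M : SimplicialMesh (m + 1))

/-- The faces of a simplex. -/
noncomputable def facesOf (T : M.Cell) : Finset M.Face := Finset.univ.filter fun F => F.1 ⊆ T.1

theorem mem_facesOf {T : M.Cell} {F : M.Face} : F ∈ M.facesOf T ↔ F.1 ⊆ T.1 := by
  simp [facesOf]

theorem card_facesOf_le (T : M.Cell) : (M.facesOf T).card ≤ m + 2 := by
  have h : ((M.facesOf T).map ⟨Subtype.val, Subtype.val_injective⟩) ⊆ T.1.powersetCard (m + 1) := by
    intro S hS
    simp only [Finset.mem_map, Function.Embedding.coeFn_mk] at hS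
    obtain ⟨F, hF, rfl⟩ := hS
    exact Finset.mem_powersetCard.mpr ⟨M.mem_facesOf.mp hF, M.card_face F⟩
  have := Finset.card_le_card h
  rw [Finset.card_map, Finset.card_powersetCard, M.card_cell T.1 T.2] at this
  simpa using this

theorem map_massCenter {V : Type*} [AddCommGroup V] [Module ℝ V] (F : M.Face)
    (g : Euc (m + 1) →ᵃ[ℝ] V) :
    g (M.massCenter F) = ((m : ℝ) + 1)⁻¹ • ∑ v ∈ F.1, g v := by
  have h1 : ∑ i ∈ F.1, F.1.centroidWeights ℝ i = 1 := by
    apply Finset.sum_centroidWeights_eq_one_of_card_ne_zero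
    rw [M.card_face]
    omega
  rw [massCenter, Finset.centroid_def, Finset.map_affineCombination _ _ _ h1,
    Finset.affineCombination_eq_linear_combination _ _ _ h1, Finset.smul_sum]
  simp [M.card_face]

/-- An affine function vanishing at the mass centers of all faces of a simplex is zero. -/
theorem eq_zero_of_massCenter (T : M.Cell) (g : Euc (m + 1) →ᵃ[ℝ] ℝ)
    (h : ∀ F : M.Face, F.1 ⊆ T.1 → g (M.massCenter F) = 0) : g = 0 := by
  classical
  have hm : (m : ℝ) + 1 ≠ 0 := by positivity
  -- On the face opposite to `v` the vertex values sum to zero, so `g v` equals the sum over all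
  -- vertices. Adding this up over the `m + 2` vertices forces that sum to vanish.
  have h1 : ∀ v ∈ T.1, g v = ∑ w ∈ T.1, g w := by
    intro v hv
    have hmem : T.1.erase v ∈ M.faces := by
      simp only [faces, Finset.mem_biUnion, Finset.mem_powersetCard]
      refine ⟨T.1, T.2, Finset.erase_subset _ _, ?_⟩
      rw [Finset.card_erase_of_mem hv, M.card_cell T.1 T.2]
      rfl
    have h2 := h ⟨_, hmem⟩ (Finset.erase_subset _ _)
    rw [map_massCenter, smul_eq_mul, mul_eq_zero] at h2
    have h3 := h2.resolve_left (inv_ne_zero hm)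
    rw [← Finset.add_sum_erase _ _ hv, h3, add_zero]
  have h2 : ∑ w ∈ T.1, g w = 0 := by
    have := Finset.sum_congr rfl h1
    rw [Finset.sum_const, M.card_cell T.1 T.2, nsmul_eq_mul] at this
    push_cast at this
    have h3 : ((m : ℝ) + 1) * ∑ w ∈ T.1, g w = 0 := by linarith
    exact (mul_eq_zero.mp h3).resolve_left hm
  ext x
  rw [(M.cellBasis T).map_eq_sum_coord g x]
  refine Finset.sum_eq_zero fun v _ => ?_
  have : g (M.cellBasis T v) = 0 := (h1 v.1 v.2).trans h2
  rw [this, smul_zero]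

/-- The affine function on `T` that is `1` at the mass center of `F` and `0` at those of the
other faces. -/
noncomputable def crFun (T : M.Cell) (F : M.Face) : Euc (m + 1) →ᵃ[ℝ] ℝ :=
  AffineMap.const ℝ (Euc (m + 1)) 1 - ((m : ℝ) + 1) • M.oppCoord T F

open Classical in
theorem crBasis_apply (F : M.Face) (T T' : M.Cell) :
    M.crBasis F T T' = if T' = T then M.crFun T F else 0 := by
  simp [crBasis, crFun]

theorem gradLinear_crFun (T : M.Cell) (F : M.Face) :
    AffineMap.gradLinear (M.crFun T F) = -(((m : ℝ) + 1) • M.oppGrad T F) := by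
  rw [crFun, map_sub, map_smul, AffineMap.gradLinear_const, zero_sub]
  rfl

open Classical in
theorem crFun_massCenter {T : M.Cell} {F F' : M.Face} (hF : F.1 ⊆ T.1) (hF' : F'.1 ⊆ T.1) :
    M.crFun T F (M.massCenter F') = if F' = F then 1 else 0 := by
  have := M.crBasis_massCenter (Nat.succ_pos m) T F F' hF hF'
  rwa [crBasis_apply, if_pos rfl] at this

/-- Both sides agree at the mass centers of all faces of `T`, which determine an affine function. -/
theorem sum_massCenter_smul_crFun (T : M.Cell) (g : Euc (m + 1) →ᵃ[ℝ] ℝ) :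
    g = ∑ F ∈ M.facesOf T, g (M.massCenter F) • M.crFun T F := by
  classical
  rw [← sub_eq_zero]
  apply M.eq_zero_of_massCenter T
  intro F hF
  rw [AffineMap.coe_sub, Pi.sub_apply, AffineMap.finset_sum_apply, sub_eq_zero, Finset.sum_eq_single F]
  · simp [M.crFun_massCenter hF hF]
  · intro F' hF' hne
    simp [M.crFun_massCenter (M.mem_facesOf.mp hF') hF, hne.symm]
  · intro h
    exact absurd (M.mem_facesOf.mpr hF) h

theorem gradLinear_eq_sum (T : M.Cell) (g : Euc (m + 1) →ᵃ[ℝ] ℝ) :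
    AffineMap.gradLinear g =
      -(((m : ℝ) + 1) • ∑ F ∈ M.facesOf T, g (M.massCenter F) • M.oppGrad T F) := by
  conv_lhs => rw [M.sum_massCenter_smul_crFun T g]
  rw [map_sum, Finset.smul_sum, ← Finset.sum_neg_distrib]
  refine Finset.sum_congr rfl fun F _ => ?_
  rw [map_smul, gradLinear_crFun, smul_neg, smul_comm]

/-- The divergence theorem on a simplex for an affine function. -/
theorem cellVolume_smul_gradLinear (T : M.Cell) (g : Euc (m + 1) →ᵃ[ℝ] ℝ) :
    M.cellVolume T • AffineMap.gradLinear g =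
      ∑ F ∈ M.facesOf T, (M.area F * g (M.massCenter F)) • M.normal T F := by
  -- The gradient of the nodal expansion already has the form of a boundary sum, since `|F| n = -d
  -- |T| ∇λ`.
  rw [M.gradLinear_eq_sum T g, smul_neg, Finset.smul_sum, Finset.smul_sum,
    ← Finset.sum_neg_distrib]
  refine Finset.sum_congr rfl fun F hF => ?_
  rw [mul_comm (M.area F), mul_smul, M.area_smul_normal (M.mem_facesOf.mp hF), smul_neg,
    smul_smul, smul_smul, smul_smul]
  congr 2
  ring

end Unisolvence

/-! ### Position of the simplices that share a face -/

section Conformity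

variable {m : ℕ} (M : SimplicialMesh (m + 1))

/-- Two different simplices with a common face lie on opposite sides of it. -/
theorem oppCoord_opposite_neg {T T' : M.Cell} {F : M.Face} (hne : T ≠ T') (hF : F.1 ⊆ T.1)
    (hF' : F.1 ⊆ T'.1) {v : T.1} (hv : v.1 ∉ F.1) : M.oppCoord T' F v ≤ 0 := by
  classical
  by_contra! hpos
  have hm : (m : ℝ) + 1 ≠ 0 := by positivity
  -- One more common vertex would make the two simplices equal.
  have hinter : (T.1 : Set (Euc (m + 1))) ∩ T'.1 = F.1 := by
    rw [← Finset.coe_inter, Finset.coe_inj]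
    symm
    apply Finset.eq_of_subset_of_card_le (Finset.subset_inter hF hF')
    by_contra! hlt
    rw [M.card_face] at hlt
    have h1 : (T.1 ∩ T'.1).card = m + 2 :=
      le_antisymm ((Finset.card_le_card Finset.inter_subset_left).trans_eq (M.card_cell T.1 T.2)) hlt
    have h2 : T.1 ∩ T'.1 = T.1 := Finset.eq_of_subset_of_card_le Finset.inter_subset_left
      (by rw [h1, M.card_cell T.1 T.2])
    have h3 : T.1 ∩ T'.1 = T'.1 := Finset.eq_of_subset_of_card_le Finset.inter_subset_right
      (by rw [h1, M.card_cell T'.1 T'.2])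
    exact hne (Subtype.ext (h2.symm.trans h3))
  have hc : M.massCenter F ∈ hull F.1 := by
    apply Finset.centroid_mem_convexHull
    exact M.face_nonempty F
  -- If `v` were strictly on the inner side of `T'`, the segment from the mass center of `F` to `v`
  -- would start inside both simplices. Conformity would put its initial part into `F`, where the
  -- coordinate of `T` opposite to `F` is zero; along the segment it is `t > 0`.
  let x : ℝ → Euc (m + 1) := fun t => AffineMap.lineMap (M.massCenter F) v.1 t
  have hxT : ∀ t ∈ Set.Icc (0 : ℝ) 1, x t ∈ hull T.1 := fun t ht =>
    (convex_convexHull ℝ _).lineMap_mem (convexHull_mono (Finset.coe_subset.mpr hF) hc)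
      (subset_convexHull ℝ _ v.2) ht
  have hev : ∀ᶠ t in nhdsWithin (0 : ℝ) (Set.Ioi 0), ∀ u, 0 ≤ (M.cellBasis T').coord u (x t) := by
    rw [Filter.eventually_all]
    intro u
    have hlin : ∀ t, (M.cellBasis T').coord u (x t) =
        (1 - t) * (M.cellBasis T').coord u (M.massCenter F) + t * (M.cellBasis T').coord u v.1 := by
      intro t
      rw [AffineMap.apply_lineMap, AffineMap.lineMap_apply, vsub_eq_sub, vadd_eq_add, smul_eq_mul]
      ring
    by_cases hu : u.1 ∈ F.1
    · have h1 : 0 < (M.cellBasis T').coord u (M.massCenter F) := by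
        rw [map_massCenter, smul_eq_mul]
        apply mul_pos (by positivity)
        apply Finset.sum_pos'
        · intro i hi
          have : i = M.cellBasis T' ⟨i, hF' hi⟩ := rfl
          rw [this, (M.cellBasis T').coord_apply]
          split_ifs <;> norm_num
        · refine ⟨u.1, hu, ?_⟩
          have : u.1 = M.cellBasis T' u := rfl
          rw [this, (M.cellBasis T').coord_apply_eq]
          norm_num
      have h2 : Filter.Tendsto (fun t => (M.cellBasis T').coord u (x t)) (nhds 0)
          (nhds ((M.cellBasis T').coord u (M.massCenter F))) := by
        have hcont : Continuous fun t : ℝ => (1 - t) * (M.cellBasis T').coord u (M.massCenter F) +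
          t * (M.cellBasis T').coord u v.1 := by fun_prop
        have := hcont.tendsto 0
        simp only [sub_zero, one_mul, zero_mul, add_zero] at this
        simpa only [hlin] using this
      exact ((h2.eventually (lt_mem_nhds h1)).filter_mono nhdsWithin_le_nhds).mono fun t ht => ht.le
    · filter_upwards [self_mem_nhdsWithin] with t ht
      rw [hlin, ← M.oppCoord_eq T' F u hu hF', M.oppCoord_eq_zero_of_mem_hull hF' hc]
      have : 0 < t := ht
      nlinarith
  have hev2 : ∀ᶠ t in nhdsWithin (0 : ℝ) (Set.Ioi 0), t ∈ Set.Ioo (0 : ℝ) 1 :=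
    Ioo_mem_nhdsGT one_pos
  obtain ⟨t, ht1, ht2⟩ := (hev.and hev2).exists
  have hxT' : x t ∈ hull T'.1 := (M.mem_hull_cell_iff T' _).mpr ht1
  have hxF := M.conforming T.1 T.2 T'.1 T'.2 ⟨hxT t ⟨ht2.1.le, ht2.2.le⟩, hxT'⟩
  rw [hinter] at hxF
  have h0 := M.oppCoord_eq_zero_of_mem_hull hF hxF
  have h1 : M.oppCoord T F (x t) = t := by
    simp only [x, AffineMap.apply_lineMap, M.oppCoord_eq_zero_of_mem_hull hF hc,
      (M.oppCoord_vertex T F hF v).2 hv]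
    simp [AffineMap.lineMap_apply]
  linarith [ht2.1]

/-- The barycentric coordinates opposite to a common face are multiples of each other. -/
theorem oppGrad_eq_smul {T T' : M.Cell} {F : M.Face} (hF : F.1 ⊆ T.1)
    (hF' : F.1 ⊆ T'.1) {v : T.1} (hv : v.1 ∉ F.1) :
    M.oppGrad T' F = M.oppCoord T' F v • M.oppGrad T F := by
  have h : M.oppCoord T' F = M.oppCoord T' F v • M.oppCoord T F := by
    ext x
    rw [(M.cellBasis T).map_eq_sum_coord (M.oppCoord T' F) x, M.oppCoord_eq T F v hv hF,
      Finset.sum_eq_single v]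
    · simp only [AffineMap.coe_smul, Pi.smul_apply, smul_eq_mul]
      rw [mul_comm]
      rfl
    · intro u _ hu
      have huF : u.1 ∈ F.1 := by
        classical
        have := M.cell_eq_insert hF hv
        have h2 : u.1 ∈ insert v.1 F.1 := this ▸ u.2
        exact (Finset.mem_insert.mp h2).resolve_left fun h => hu (Subtype.ext h)
      have : M.oppCoord T' F (M.cellBasis T u) = 0 :=
        (M.oppCoord_vertex T' F hF' ⟨u.1, hF' huF⟩).1 huF
      rw [this, smul_zero]
    · simp
  exact (congrArg AffineMap.gradLinear h).trans (map_smul _ _ _)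

/-- The two barycentric gradients are proportional. The factor is the coordinate of `T'` at the
vertex of `T` opposite to `F`: nonpositive by conformity, nonzero because the gradient of `T'` is.
-/
theorem normal_eq_neg {T T' : M.Cell} {F : M.Face} (hne : T ≠ T') (hF : F.1 ⊆ T.1)
    (hF' : F.1 ⊆ T'.1) : M.normal T' F = -M.normal T F := by
  obtain ⟨v, hv⟩ := M.exists_opposite T F hF
  have h1 := M.oppCoord_opposite_neg hne hF hF' hv
  have h2 := M.oppGrad_eq_smul hF hF' hv
  have h3 : M.oppCoord T' F v ≠ 0 := by
    intro h
    rw [h, zero_smul] at h2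
    exact M.oppGrad_ne_zero hF' h2
  have h4 : M.oppCoord T' F v < 0 := lt_of_le_of_ne h1 h3
  rw [normal_eq, normal_eq, h2, norm_smul, Real.norm_eq_abs, abs_of_neg h4, mul_inv, smul_smul,
    neg_neg, ← neg_smul]
  congr 1
  field_simp

theorem norm_normal {T : M.Cell} {F : M.Face} (hF : F.1 ⊆ T.1) : ‖M.normal T F‖ = 1 :=
  (M.normal_spec (Nat.succ_pos m) T F hF).1

/-- No face lies in three simplices. -/
theorem eq_or_eq_of_subset {T T' T'' : M.Cell} {F : M.Face} (hne : T ≠ T') (hF : F.1 ⊆ T.1)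
    (hF' : F.1 ⊆ T'.1) (hF'' : F.1 ⊆ T''.1) : T'' = T ∨ T'' = T' := by
  by_contra! h
  -- Three unit normals cannot be pairwise opposite.
  have h1 := M.normal_eq_neg hne hF hF'
  have h2 := M.normal_eq_neg h.1 hF'' hF
  have h3 := M.normal_eq_neg h.2 hF'' hF'
  have h4 := M.norm_normal hF''
  rw [h2, h3, neg_neg] at h1
  have h5 : M.normal T'' F = 0 := by
    linear_combination (norm := module) (-(1 / 2 : ℝ)) • h1
  rw [h5, norm_zero] at h4
  exact zero_ne_one h4

end Conformity

end SimplicialMesh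

/-! ### Preconditioned conjugate gradients: one-step energy reduction -/

section ConjugateGradient

variable {ι : Type} [Fintype ι] {A : Matrix ι ι ℝ} {D b x : ι → ℝ}

/-- The invariants of the preconditioned conjugate gradient iteration, where `s.r / D` is the
preconditioned residual: the residual is the actual one, and the search direction differs from the preconditioned residual by a
direction that is orthogonal to the residual and `A`-orthogonal to the search direction. -/
structure PCGInvariant (A : Matrix ι ι ℝ) (D b : ι → ℝ) (s : PCGState ι) : Prop where
  residual : s.r = b - A *ᵥ s.x
  dot_residual : s.p ⬝ᵥ s.r = (s.r / D) ⬝ᵥ s.r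
  conj : (s.r / D) ⬝ᵥ (A *ᵥ s.p) = s.p ⬝ᵥ (A *ᵥ s.p)
  eq_zero : s.r = 0 → s.p = 0

omit [Fintype ι] in
theorem zero_div_fun (D : ι → ℝ) : (0 : ι → ℝ) / D = 0 := by
  ext i
  simp

theorem pcgInvariant_init (x₀ : ι → ℝ) : PCGInvariant A D b (pcgInit A D b x₀) where
  residual := rfl
  dot_residual := rfl
  conj := rfl
  eq_zero h := by
    change (b - A *ᵥ x₀) / D = 0
    have h' : b - A *ᵥ x₀ = 0 := h
    rw [h', zero_div_fun]

theorem Matrix.PosDef.dotProduct_mulVec_comm (hA : A.PosDef) (u v : ι → ℝ) :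
    u ⬝ᵥ (A *ᵥ v) = v ⬝ᵥ (A *ᵥ u) := by
  have h : Aᵀ = A := by
    have := hA.isHermitian
    rwa [Matrix.IsHermitian, Matrix.conjTranspose_eq_transpose_of_trivial] at this
  rw [Matrix.dotProduct_mulVec, ← Matrix.mulVec_transpose, h, dotProduct_comm]

theorem Matrix.PosDef.dotProduct_mulVec_self_pos (hA : A.PosDef) {u : ι → ℝ} (hu : u ≠ 0) :
    0 < u ⬝ᵥ (A *ᵥ u) := by
  simpa using hA.dotProduct_mulVec_pos hu

theorem Matrix.PosDef.dotProduct_mulVec_self_nonneg (hA : A.PosDef) (u : ι → ℝ) :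
    0 ≤ u ⬝ᵥ (A *ᵥ u) := by
  simpa using hA.posSemidef.dotProduct_mulVec_nonneg u

theorem dotProduct_div_self_pos (hD : ∀ i, 0 < D i) {r : ι → ℝ} (hr : r ≠ 0) :
    0 < (r / D) ⬝ᵥ r := by
  obtain ⟨i, hi⟩ := Function.ne_iff.mp hr
  have h : ∀ j, (r / D) j * r j = r j ^ 2 / D j := fun j => by
    simp only [Pi.div_apply]; ring
  apply Finset.sum_pos'
  · intro j _
    rw [h]
    have := hD j
    positivity
  · refine ⟨i, Finset.mem_univ _, ?_⟩
    rw [h]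
    have := hD i
    have hi' : r i ≠ 0 := hi
    positivity

theorem dotProduct_div_comm (D u v : ι → ℝ) : (u / D) ⬝ᵥ v = (v / D) ⬝ᵥ u := by
  refine Finset.sum_congr rfl fun i _ => ?_
  simp only [Pi.div_apply]; ring

/-- The step length makes the new residual orthogonal to `p` and to the old preconditioned residual;
the choice of `c` makes the new direction `A`-orthogonal to `p`. Only these consecutive
orthogonalities are needed, not those against the whole history. -/
theorem PCGInvariant.step (hA : A.PosDef) (hD : ∀ i, 0 < D i) {s : PCGState ι}
    (hs : PCGInvariant A D b s) : PCGInvariant A D b (pcgStep A D s) := by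
  obtain ⟨x, r, p⟩ := s
  obtain ⟨h1, h2, h3, h4⟩ := hs
  simp only at h1 h2 h3 h4
  -- After convergence the quotients are `0 / 0 = 0`, and since `p = 0` as well the state is
  -- stationary.
  by_cases hr : r = 0
  · have hp := h4 hr
    subst hr
    subst hp
    have hstep : pcgStep A D ⟨x, 0, 0⟩ = ⟨x, 0, 0⟩ := by
      simp [pcgStep, zero_div_fun]
    rw [hstep]
    exact ⟨h1, h2, h3, h4⟩
  · have hrs := dotProduct_div_self_pos hD hr
    have hp : p ≠ 0 := by
      rintro rfl
      rw [zero_dotProduct] at h2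
      linarith
    have hpp := hA.dotProduct_mulVec_self_pos hp
    have hrs' : r ⬝ᵥ (r / D) = (r / D) ⬝ᵥ r := dotProduct_comm _ _
    set a : ℝ := (r ⬝ᵥ (r / D)) / (p ⬝ᵥ (A *ᵥ p)) with ha
    have ha0 : a ≠ 0 := by
      rw [ha, hrs']
      positivity
    have hap : a * (p ⬝ᵥ (A *ᵥ p)) = (r / D) ⬝ᵥ r := by
      rw [ha, hrs', div_mul_cancel₀ _ hpp.ne']
    set r' : ι → ℝ := r - a • (A *ᵥ p) with hr'
    set c : ℝ := (r' ⬝ᵥ (r' / D)) / (r ⬝ᵥ (r / D)) with hc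
    have hcr : c * ((r / D) ⬝ᵥ r) = (r' / D) ⬝ᵥ r' := by
      rw [hc, hrs', div_mul_cancel₀ _ hrs.ne', dotProduct_comm]
    have hstep : pcgStep A D ⟨x, r, p⟩ = ⟨x + a • p, r', r' / D + c • p⟩ := rfl
    rw [hstep]
    have hsr' : (r / D) ⬝ᵥ r' = 0 := by
      rw [hr', dotProduct_sub, dotProduct_smul, smul_eq_mul, h3, hap, sub_self]
    have hpr' : p ⬝ᵥ r' = 0 := by
      rw [hr', dotProduct_sub, dotProduct_smul, smul_eq_mul, h2, hap, sub_self]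
    have hs'r : (r' / D) ⬝ᵥ r = 0 := by rw [dotProduct_div_comm, hsr']
    have hs'Ap : a * ((r' / D) ⬝ᵥ (A *ᵥ p)) = -((r' / D) ⬝ᵥ r') := by
      have : (r' / D) ⬝ᵥ r' = (r' / D) ⬝ᵥ (r - a • (A *ᵥ p)) := by rw [← hr']
      rw [this, dotProduct_sub, dotProduct_smul, smul_eq_mul, hs'r]
      ring
    have hp'Ap : (r' / D + c • p) ⬝ᵥ (A *ᵥ p) = 0 := by
      rw [add_dotProduct, smul_dotProduct, smul_eq_mul]
      have : a * ((r' / D) ⬝ᵥ (A *ᵥ p) + c * (p ⬝ᵥ (A *ᵥ p))) = 0 := by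
        rw [mul_add, hs'Ap, mul_left_comm, hap, hcr]
        ring
      exact (mul_eq_zero.mp this).resolve_left ha0
    refine ⟨?_, ?_, ?_, ?_⟩
    · simp only
      rw [hr', h1, Matrix.mulVec_add, Matrix.mulVec_smul, sub_sub]
    · simp only
      rw [add_dotProduct, smul_dotProduct, hpr', smul_zero, add_zero]
    · simp only
      set p' := r' / D + c • p with hp'
      have : r' / D = p' - c • p := by rw [hp', add_sub_cancel_right]
      rw [this, sub_dotProduct, smul_dotProduct, hA.dotProduct_mulVec_comm p p', hp'Ap,
        smul_zero, sub_zero]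
    · simp only
      intro h
      rw [hc, h]
      simp [zero_div_fun]

/-- One step of the method reduces the energy error. -/
theorem PCGInvariant.energy_step (hA : A.PosDef) (hD : ∀ i, 0 < D i) {c C : ℝ} (hc : 0 < c)
    (hC : 0 < C) (hlow : ∀ u : ι → ℝ, c * ∑ i, D i * u i ^ 2 ≤ u ⬝ᵥ (A *ᵥ u))
    (hupp : ∀ u : ι → ℝ, u ⬝ᵥ (A *ᵥ u) ≤ C * ∑ i, D i * u i ^ 2) {s : PCGState ι}
    (hs : PCGInvariant A D b s) (hx : A *ᵥ x = b) :
    (x - (pcgStep A D s).x) ⬝ᵥ (A *ᵥ (x - (pcgStep A D s).x)) ≤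
      (1 - c / C) * ((x - s.x) ⬝ᵥ (A *ᵥ (x - s.x))) := by
  obtain ⟨y, r, p⟩ := s
  obtain ⟨h1, h2, h3, h4⟩ := hs
  simp only at h1 h2 h3 h4 ⊢
  set e := x - y with he
  have hAe : A *ᵥ e = r := by rw [he, Matrix.mulVec_sub, hx, h1]
  by_cases hr : r = 0
  · have hp := h4 hr
    subst hr
    subst hp
    have hstep : pcgStep A D ⟨y, 0, 0⟩ = ⟨y, 0, 0⟩ := by
      simp [pcgStep, zero_div_fun]
    rw [hstep]
    simp only
    rw [← he, hAe]
    simp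
  have hrs := dotProduct_div_self_pos hD hr
  have hp : p ≠ 0 := by
    rintro rfl
    rw [zero_dotProduct] at h2
    linarith
  have hpp := hA.dotProduct_mulVec_self_pos hp
  have hrs' : r ⬝ᵥ (r / D) = (r / D) ⬝ᵥ r := dotProduct_comm _ _
  set τ := (r / D) ⬝ᵥ r with hτ
  have hstep : (pcgStep A D ⟨y, r, p⟩).x = y + (τ / (p ⬝ᵥ (A *ᵥ p))) • p := by
    rw [← hrs']; rfl
  set P := p ⬝ᵥ (A *ᵥ p) with hP
  have hnew : x - (pcgStep A D ⟨y, r, p⟩).x = e - (τ / P) • p := by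
    rw [hstep, he, sub_sub]
  -- Exact line search: `e ⬝ᵥ A p = p ⬝ᵥ r = τ`, so the squared energy drops by exactly `τ ^ 2 / P`.
  have hexp : (e - (τ / P) • p) ⬝ᵥ (A *ᵥ (e - (τ / P) • p)) = e ⬝ᵥ (A *ᵥ e) - τ ^ 2 / P := by
    rw [Matrix.mulVec_sub, Matrix.mulVec_smul, sub_dotProduct, dotProduct_sub, dotProduct_sub,
      smul_dotProduct, smul_dotProduct, dotProduct_smul, dotProduct_smul,
      hA.dotProduct_mulVec_comm e p, hAe, h2, ← hP]
    simp only [smul_eq_mul]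
    field_simp
    ring
  -- `r / D - p` is `A`-orthogonal to `p`, so by Pythagoras the energy of `p` is at most that of the
  -- preconditioned residual `r / D`.
  have hsAs : P ≤ C * τ := by
    have h5 := hA.dotProduct_mulVec_self_nonneg (r / D - p)
    rw [Matrix.mulVec_sub, sub_dotProduct, dotProduct_sub, dotProduct_sub,
      hA.dotProduct_mulVec_comm p (r / D), h3, ← hP] at h5
    have h6 := hupp (r / D)
    have h7 : ∑ i, D i * (r / D) i ^ 2 = τ := by
      refine Finset.sum_congr rfl fun i _ => ?_
      have := (hD i).ne'
      simp only [Pi.div_apply]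
      field_simp
    rw [h7] at h6
    linarith
  have heAe : c * (e ⬝ᵥ (A *ᵥ e)) ≤ τ := by
    -- Cauchy-Schwarz for `e ⬝ᵥ r`, with the weights `D` on `e` and `1 / D` on `r`.
    have hcs : (e ⬝ᵥ (A *ᵥ e)) ^ 2 ≤ (∑ i, D i * e i ^ 2) * τ := by
      rw [hAe]
      refine Finset.sum_sq_le_sum_mul_sum_of_sq_le_mul _ (fun i _ => ?_) (fun i _ => ?_)
        (fun i _ => ?_)
      · have := hD i
        positivity
      · simp only [Pi.div_apply]
        have := hD i
        have h8 : r i / D i * r i = r i ^ 2 / D i := by ring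
        rw [h8]
        positivity
      · simp only [Pi.div_apply]
        have := (hD i).ne'
        apply le_of_eq
        field_simp
    have hEpos : 0 ≤ e ⬝ᵥ (A *ᵥ e) := hA.dotProduct_mulVec_self_nonneg e
    rcases hEpos.eq_or_lt with h0 | h0
    · rw [← h0]; linarith
    · have h9 := mul_le_mul_of_nonneg_right (hlow e) hrs.le
      have h10 : c * (e ⬝ᵥ (A *ᵥ e)) * (e ⬝ᵥ (A *ᵥ e)) ≤ τ * (e ⬝ᵥ (A *ᵥ e)) := by nlinarith
      exact le_of_mul_le_mul_right h10 h0
  rw [hnew, hexp]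
  have h11 : c / C * (e ⬝ᵥ (A *ᵥ e)) ≤ τ ^ 2 / P := by
    rw [le_div_iff₀ hpp, div_mul_eq_mul_div, div_mul_eq_mul_div, div_le_iff₀ hC]
    calc c * (e ⬝ᵥ (A *ᵥ e)) * P ≤ τ * (C * τ) :=
          mul_le_mul heAe hsAs hpp.le hrs.le
      _ = τ ^ 2 * C := by ring
  linarith

theorem pcgInvariant_iterate (hA : A.PosDef) (hD : ∀ i, 0 < D i) (x₀ : ι → ℝ) (k : ℕ) :
    PCGInvariant A D b ((pcgStep A D)^[k] (pcgInit A D b x₀)) := by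
  induction k with
  | zero => exact pcgInvariant_init x₀
  | succ k ih =>
    rw [Function.iterate_succ_apply']
    exact ih.step hA hD

/-- Convergence of the preconditioned conjugate gradient method with a spectrally equivalent
diagonal preconditioner. -/
theorem energyNorm_pcgIterate_le (hA : A.PosDef) (hD : ∀ i, 0 < D i) {c C : ℝ} (hc : 0 < c)
    (hC : 0 < C) (hlow : ∀ u : ι → ℝ, c * ∑ i, D i * u i ^ 2 ≤ u ⬝ᵥ (A *ᵥ u))
    (hupp : ∀ u : ι → ℝ, u ⬝ᵥ (A *ᵥ u) ≤ C * ∑ i, D i * u i ^ 2) {q : ℝ} (hq : 1 - c / C ≤ q)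
    (hx : A *ᵥ x = b) (x₀ : ι → ℝ) (k : ℕ) :
    energyNorm A (x - pcgIterate A D b x₀ k) ≤ √q ^ k * energyNorm A (x - x₀) := by
  induction k with
  | zero => simp [pcgIterate, pcgInit]
  | succ k ih =>
    have hstep := (pcgInvariant_iterate (b := b) hA hD x₀ k).energy_step hA hD hc hC hlow hupp hx
    have h1 : energyNorm A (x - pcgIterate A D b x₀ (k + 1)) ≤
        √q * energyNorm A (x - pcgIterate A D b x₀ k) := by
      rw [energyNorm, energyNorm, ← Real.sqrt_mul' _ (hA.dotProduct_mulVec_self_nonneg _)]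
      apply Real.sqrt_le_sqrt
      rw [pcgIterate, Function.iterate_succ_apply']
      exact hstep.trans (mul_le_mul_of_nonneg_right hq (hA.dotProduct_mulVec_self_nonneg _))
    calc _ ≤ √q * energyNorm A (x - pcgIterate A D b x₀ k) := h1
      _ ≤ √q * (√q ^ k * energyNorm A (x - x₀)) :=
          mul_le_mul_of_nonneg_left ih (Real.sqrt_nonneg q)
      _ = _ := by ring

end ConjugateGradient

/-! ### The form on `Z_β` in terms of coefficients -/

namespace SimplicialMesh

namespace Labelling

variable {m : ℕ} {M : SimplicialMesh (m + 1)} (L : M.Labelling) (κ : M.Cell → ℝ)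

theorem eq_plus_or_eq_minus {F : M.Face} (hF : M.IsInterior F) {T : M.Cell} (hT : F.1 ⊆ T.1) :
    T = L.plus F ∨ T = L.minus F :=
  M.eq_or_eq_of_subset (L.plus_ne_minus F hF) (L.subset_plus F) (L.subset_minus F) hT

theorem eq_plus_of_not_isInterior {F : M.Face} (hF : ¬ M.IsInterior F) {T : M.Cell}
    (hT : F.1 ⊆ T.1) : T = L.plus F := by
  by_contra h
  exact hF ⟨T, L.plus F, h, hT, L.subset_plus F⟩

theorem normal_minus {F : M.Face} (hF : M.IsInterior F) :
    M.normal (L.minus F) F = -M.normal (L.plus F) F :=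
  M.normal_eq_neg (L.plus_ne_minus F hF) (L.subset_plus F) (L.subset_minus F)

open Classical in
/-- The sum over the simplices containing a face. -/
theorem sum_cells_of_face (F : M.Face) (f : M.Cell → ℝ) :
    ∑ T : M.Cell, (if F.1 ⊆ T.1 then f T else 0) =
      if M.IsInterior F then f (L.plus F) + f (L.minus F) else f (L.plus F) := by
  rw [← Finset.sum_filter]
  split_ifs with hF
  · have : (Finset.univ.filter fun T : M.Cell => F.1 ⊆ T.1) = {L.plus F, L.minus F} := by
      ext T
      simp only [Finset.mem_filter, Finset.mem_univ, true_and, Finset.mem_insert,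
        Finset.mem_singleton]
      refine ⟨L.eq_plus_or_eq_minus hF, ?_⟩
      rintro (rfl | rfl)
      · exact L.subset_plus F
      · exact L.subset_minus F
    rw [this, Finset.sum_pair (L.plus_ne_minus F hF)]
  · have : (Finset.univ.filter fun T : M.Cell => F.1 ⊆ T.1) = {L.plus F} := by
      ext T
      simp only [Finset.mem_filter, Finset.mem_univ, true_and, Finset.mem_singleton]
      refine ⟨L.eq_plus_of_not_isInterior hF, ?_⟩
      rintro rfl
      exact L.subset_plus F
    rw [this, Finset.sum_singleton]

open Classical in
theorem sum_cells_facesOf (f : M.Cell → M.Face → ℝ) :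
    ∑ T : M.Cell, ∑ F ∈ M.facesOf T, f T F =
      ∑ F : M.Face, if M.IsInterior F then f (L.plus F) F + f (L.minus F) F
        else f (L.plus F) F := by
  simp_rw [facesOf, Finset.sum_filter]
  rw [Finset.sum_comm]
  exact Finset.sum_congr rfl fun F _ => L.sum_cells_of_face F fun T => f T F

open Classical in
/-- The value on the simplex `T` of `ψ_F` at the mass center of the face `F` of `T`. -/
noncomputable def nodeCoeff (T : M.Cell) (F : M.Face) : ℝ :=
  if M.IsInterior F then
    if T = L.plus F then L.beta κ F else -(1 - L.beta κ F)
  else 1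

theorem nodeCoeff_plus {F : M.Face} (hF : M.IsInterior F) :
    L.nodeCoeff κ (L.plus F) F = L.beta κ F := by
  simp [nodeCoeff, hF]

theorem nodeCoeff_minus {F : M.Face} (hF : M.IsInterior F) :
    L.nodeCoeff κ (L.minus F) F = -(1 - L.beta κ F) := by
  simp [nodeCoeff, hF, (L.plus_ne_minus F hF).symm]

theorem nodeCoeff_of_not_isInterior {F : M.Face} (hF : ¬ M.IsInterior F) (T : M.Cell) :
    L.nodeCoeff κ T F = 1 := by
  simp [nodeCoeff, hF]

open Classical in
theorem psi_apply (F : M.Face) (T : M.Cell) :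
    L.psi κ F T = if F.1 ⊆ T.1 then L.nodeCoeff κ T F • M.crFun T F else 0 := by
  by_cases hF : M.IsInterior F
  · have hne := L.plus_ne_minus F hF
    have hpsi : L.psi κ F T = L.beta κ F • M.crBasis F (L.plus F) T -
        (1 - L.beta κ F) • M.crBasis F (L.minus F) T := by
      simp [psi, hF]
    rw [hpsi, crBasis_apply, crBasis_apply]
    by_cases hT : F.1 ⊆ T.1
    · rw [if_pos hT]
      rcases L.eq_plus_or_eq_minus hF hT with rfl | rfl
      · rw [L.nodeCoeff_plus κ hF]
        simp [hne]
      · rw [L.nodeCoeff_minus κ hF]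
        simp [hne.symm, sub_smul]
    · have h1 : T ≠ L.plus F := by rintro rfl; exact hT (L.subset_plus F)
      have h2 : T ≠ L.minus F := by rintro rfl; exact hT (L.subset_minus F)
      simp [hT, h1, h2]
  · have hpsi : L.psi κ F T = M.crBasis F (L.plus F) T := by
      simp [psi, hF]
    rw [hpsi, crBasis_apply, L.nodeCoeff_of_not_isInterior κ hF]
    by_cases hT : F.1 ⊆ T.1
    · obtain rfl := L.eq_plus_of_not_isInterior hF hT
      simp [hT]
    · have h1 : T ≠ L.plus F := by rintro rfl; exact hT (L.subset_plus F)
      simp [hT, h1]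

/-- The function `∑ a_F ψ_F`, as a linear function of its coefficients. -/
noncomputable def combine : (M.Face → ℝ) →ₗ[ℝ] M.DG := Fintype.linearCombination ℝ (L.psi κ)

theorem combine_eq (a : M.Face → ℝ) : L.combine κ a = ∑ F, a F • L.psi κ F := rfl

theorem combine_massCenter (a : M.Face → ℝ) {T : M.Cell} {F : M.Face} (hF : F.1 ⊆ T.1) :
    L.combine κ a T (M.massCenter F) = L.nodeCoeff κ T F * a F := by
  classical
  rw [combine_eq, Finset.sum_apply, AffineMap.finset_sum_apply, Finset.sum_eq_single F]
  · simp [psi_apply, hF, M.crFun_massCenter hF hF, mul_comm]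
  · intro G _ hG
    by_cases hGT : G.1 ⊆ T.1
    · simp [psi_apply, hGT, M.crFun_massCenter hGT hF, hG.symm]
    · simp [psi_apply, hGT]
  · simp

open Classical in
/-- The jump as an affine map. -/
noncomputable def jumpMap (v : M.DG) (F : M.Face) : Euc (m + 1) →ᵃ[ℝ] Euc (m + 1) :=
  if M.IsInterior F then
    (LinearMap.toSpanSingleton ℝ _ (M.normal (L.plus F) F)).toAffineMap.comp (v (L.plus F)) +
      (LinearMap.toSpanSingleton ℝ _ (M.normal (L.minus F) F)).toAffineMap.comp (v (L.minus F))
  else (LinearMap.toSpanSingleton ℝ _ (M.normal (L.plus F) F)).toAffineMap.comp (v (L.plus F))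

theorem jump_eq (v : M.DG) (F : M.Face) : L.jump v F = L.jumpMap v F := by
  funext x
  unfold jump jumpMap
  split_ifs <;> simp

/-- The nodal values on the two sides are `β a_F` and `-(1 - β) a_F`; as the normals are opposite,
their jump adds up to `a_F`. -/
theorem jump_combine_massCenter (a : M.Face → ℝ) (F : M.Face) :
    L.jump (L.combine κ a) F (M.massCenter F) = a F • M.normal (L.plus F) F := by
  by_cases hF : M.IsInterior F
  · rw [jump, if_pos hF, L.combine_massCenter κ a (L.subset_plus F),
      L.combine_massCenter κ a (L.subset_minus F), L.normal_minus hF, L.nodeCoeff_plus κ hF,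
      L.nodeCoeff_minus κ hF, smul_neg, ← neg_smul, ← add_smul]
    congr 1
    ring
  · rw [jump, if_neg hF, L.combine_massCenter κ a (L.subset_plus F),
      L.nodeCoeff_of_not_isInterior κ hF, one_mul]

theorem proj0_jump_combine (a : M.Face → ℝ) (F : M.Face) :
    M.proj0 F (L.jump (L.combine κ a) F) = a F • M.normal (L.plus F) F := by
  rw [← L.jump_combine_massCenter κ, jump_eq, M.proj0_affineMap]

/-- Against a constant vector only the mean jump counts. This serves the flux terms and, with `u`
the scaled projected jump, the penalty term. -/
theorem faceInt_inner_jump_combine (u : Euc (m + 1)) (a : M.Face → ℝ) (F : M.Face) :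
    M.faceInt F (fun x => inner ℝ u (L.jump (L.combine κ a) F x)) =
      M.area F * (a F * inner ℝ u (M.normal (L.plus F) F)) := by
  have h := M.faceInt_affineMap F
    ((innerSL ℝ u).toLinearMap.toAffineMap.comp (L.jumpMap (L.combine κ a) F))
  have h2 : L.jumpMap (L.combine κ a) F (M.massCenter F) = a F • M.normal (L.plus F) F := by
    rw [← jump_eq, jump_combine_massCenter]
  rw [jump_eq, ← real_inner_smul_right, ← h2]
  exact h

theorem avgFlux_eq (v : M.DG) (F : M.Face) (x : Euc (m + 1)) :
    L.avgFlux κ v F x = L.avgFlux κ v F 0 := by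
  simp only [avgFlux, AffineMap.gradient_eq_gradLinear]

variable (M) in
/-- The bilinear form `∑_T ∫_T κ ∇v ⬝ ∇w` for piecewise affine functions. -/
noncomputable def stiffness (v w : M.DG) : ℝ :=
  ∑ T : M.Cell, κ T * M.cellVolume T *
    inner ℝ (AffineMap.gradLinear (v T)) (AffineMap.gradLinear (w T))

theorem stiffness_comm (v w : M.DG) : stiffness M κ v w = stiffness M κ w v :=
  Finset.sum_congr rfl fun T _ => by rw [real_inner_comm]

theorem stiffness_eq_integral (v w : M.DG) :
    ∑ T : M.Cell, ∫ x in hull T.1, κ T * inner ℝ (gradient (v T) x) (gradient (w T) x) =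
      stiffness M κ v w := by
  refine Finset.sum_congr rfl fun T _ => ?_
  simp only [AffineMap.gradient_eq_gradLinear]
  rw [setIntegral_const, smul_eq_mul, cellVolume]
  ring

/-- Integration by parts. -/
theorem stiffness_combine_right (v : M.DG) (b : M.Face → ℝ) :
    stiffness M κ v (L.combine κ b) =
      ∑ F : M.Face, M.area F * (b F * inner ℝ (L.avgFlux κ v F 0) (M.normal (L.plus F) F)) := by
  classical
  have h : ∀ T : M.Cell, κ T * M.cellVolume T *
      inner ℝ (AffineMap.gradLinear (v T)) (AffineMap.gradLinear (L.combine κ b T)) =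
      ∑ F ∈ M.facesOf T, κ T * (M.area F * (L.nodeCoeff κ T F * b F)) *
        inner ℝ (AffineMap.gradLinear (v T)) (M.normal T F) := by
    intro T
    rw [mul_assoc, ← real_inner_smul_right, M.cellVolume_smul_gradLinear, inner_sum, Finset.mul_sum]
    refine Finset.sum_congr rfl fun F hF => ?_
    rw [real_inner_smul_right, L.combine_massCenter κ b (M.mem_facesOf.mp hF)]
    ring
  rw [stiffness, Finset.sum_congr rfl fun T _ => h T, L.sum_cells_facesOf]
  refine Finset.sum_congr rfl fun F _ => ?_
  -- On the minus side the signs of `-(1 - β)` and of the normal cancel, so the two contributions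
  -- combine exactly into the `β`-weighted flux.
  by_cases hF : M.IsInterior F
  · rw [if_pos hF, avgFlux, if_pos hF, L.nodeCoeff_plus κ hF, L.nodeCoeff_minus κ hF,
      L.normal_minus hF, inner_neg_right, inner_add_left]
    simp only [real_inner_smul_left, AffineMap.gradient_eq_gradLinear]
    ring
  · rw [if_neg hF, avgFlux, if_neg hF, L.nodeCoeff_of_not_isInterior κ hF]
    simp only [real_inner_smul_left, AffineMap.gradient_eq_gradLinear]
    ring

/-- On `Z_β` the consistency term cancels the volume term. -/
theorem formA0_combine (s : SizeKind) (θ α : ℝ) (a b : M.Face → ℝ) :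
    L.formA0 κ s θ α (L.combine κ a) (L.combine κ b) =
      θ * stiffness M κ (L.combine κ a) (L.combine κ b) + α * L.starInner κ s a b := by
  have h2 : ∑ F : M.Face, M.faceInt F (fun x => inner ℝ (L.avgFlux κ (L.combine κ a) F x)
      (L.jump (L.combine κ b) F x)) = stiffness M κ (L.combine κ a) (L.combine κ b) := by
    rw [stiffness_combine_right]
    refine Finset.sum_congr rfl fun F _ => ?_
    simp only [L.avgFlux_eq κ _ F]
    exact L.faceInt_inner_jump_combine κ _ b F
  have h3 : ∑ F : M.Face, M.faceInt F (fun x => inner ℝ (L.jump (L.combine κ a) F x)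
      (L.avgFlux κ (L.combine κ b) F x)) = stiffness M κ (L.combine κ a) (L.combine κ b) := by
    rw [stiffness_comm, stiffness_combine_right]
    refine Finset.sum_congr rfl fun F _ => ?_
    have h : ∀ x, inner ℝ (L.jump (L.combine κ a) F x) (L.avgFlux κ (L.combine κ b) F x) =
        inner ℝ (L.avgFlux κ (L.combine κ b) F 0) (L.jump (L.combine κ a) F x) := fun x => by
      rw [real_inner_comm, L.avgFlux_eq κ _ F]
    simp only [h]
    exact L.faceInt_inner_jump_combine κ _ a F
  have h4 : ∑ F : M.Face, M.faceInt F (fun x =>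
      α * (M.faceSize s F)⁻¹ * L.kappaFace κ F *
        inner ℝ (M.proj0 F (L.jump (L.combine κ a) F)) (L.jump (L.combine κ b) F x)) =
      α * L.starInner κ s a b := by
    rw [starInner, Finset.mul_sum]
    refine Finset.sum_congr rfl fun F _ => ?_
    simp only [← real_inner_smul_left]
    rw [L.faceInt_inner_jump_combine κ, L.proj0_jump_combine κ, smul_smul, real_inner_smul_left,
      real_inner_self_eq_norm_sq, M.norm_normal (L.subset_plus F), starWeight]
    ring
  rw [formA0, h2, h3, h4, stiffness_eq_integral]
  ring

/-! ### Basis property and the bound for the volume form -/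

section Positive

variable {κ} (hκ : ∀ T, 0 < κ T)
include hκ

theorem beta_pos (F : M.Face) : 0 < L.beta κ F :=
  div_pos (hκ _) (add_pos (hκ _) (hκ _))

theorem kappaFace_pos (F : M.Face) : 0 < L.kappaFace κ F := by
  have h1 := hκ (L.plus F)
  have h2 := hκ (L.minus F)
  rw [kappaFace]
  split_ifs <;> positivity

theorem starWeight_pos (hm : 1 ≤ m) (s : SizeKind) (F : M.Face) : 0 < L.starWeight κ s F :=
  mul_pos (div_pos (M.area_pos F) (M.faceSize_pos hm s F)) (L.kappaFace_pos hκ F)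

/-- The coefficient of `F` is read off at its mass center from the plus side, where `ψ_F` has the
nonzero value `β_F` or `1`. -/
theorem combine_injective : Function.Injective (L.combine κ) := by
  intro a b hab
  funext F
  have h1 := L.combine_massCenter κ a (L.subset_plus F)
  rw [hab, L.combine_massCenter κ b (L.subset_plus F)] at h1
  refine (mul_left_cancel₀ ?_ h1).symm
  by_cases hF : M.IsInterior F
  · rw [L.nodeCoeff_plus κ hF]
    exact (L.beta_pos hκ F).ne'
  · rw [L.nodeCoeff_of_not_isInterior κ hF]
    exact one_ne_zero

-- The coefficient must be the jump `a = z⁺ - z⁻` at the mass center (the value itself on a boundary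
-- face). Together with `(1 - β) z⁺ + β z⁻ = 0` it gives back `z⁺ = β a` and `z⁻ = -(1 - β) a`.
omit hκ in
theorem exists_combine_eq {z : M.DG} (hz : z ∈ L.spaceZ κ) : ∃ a, z = L.combine κ a := by
  classical
  refine ⟨fun F => if M.IsInterior F then
    z (L.plus F) (M.massCenter F) - z (L.minus F) (M.massCenter F)
    else z (L.plus F) (M.massCenter F), ?_⟩
  funext T
  rw [← sub_eq_zero]
  apply M.eq_zero_of_massCenter T
  intro F hF
  rw [AffineMap.coe_sub, Pi.sub_apply, L.combine_massCenter κ _ hF, sub_eq_zero]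
  by_cases hFi : M.IsInterior F
  · have h := hz F hFi
    have h2 : L.avgCompl κ z F =
        ((1 - L.beta κ F) • z (L.plus F) + L.beta κ F • z (L.minus F) : Euc (m + 1) →ᵃ[ℝ] ℝ) := by
      funext x
      simp [avgCompl]
    rw [h2, M.proj0_affineMap] at h
    simp only [AffineMap.coe_add, AffineMap.coe_smul, Pi.add_apply, Pi.smul_apply, smul_eq_mul] at h
    rw [if_pos hFi]
    rcases L.eq_plus_or_eq_minus hFi hF with rfl | rfl
    · rw [L.nodeCoeff_plus κ hFi]
      linarith
    · rw [L.nodeCoeff_minus κ hFi]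
      linarith
  · rw [L.nodeCoeff_of_not_isInterior κ hFi, if_neg hFi, one_mul,
      L.eq_plus_of_not_isInterior hFi hF]

-- On an interior face the left side is `κ⁺ κ⁻ / (κ⁺ + κ⁻)`, half the harmonic mean, whatever the
-- contrast. This makes the constants independent of `κ`.
open Classical in
theorem sum_kappa_nodeCoeff_sq_le (F : M.Face) :
    (if M.IsInterior F then κ (L.plus F) * L.nodeCoeff κ (L.plus F) F ^ 2 +
      κ (L.minus F) * L.nodeCoeff κ (L.minus F) F ^ 2
      else κ (L.plus F) * L.nodeCoeff κ (L.plus F) F ^ 2) ≤ L.kappaFace κ F := by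
  have h1 := hκ (L.plus F)
  have h2 := hκ (L.minus F)
  by_cases hF : M.IsInterior F
  · rw [if_pos hF, kappaFace, if_pos hF, L.nodeCoeff_plus κ hF, L.nodeCoeff_minus κ hF, beta]
    have h3 : κ (L.plus F) * (κ (L.minus F) / (κ (L.plus F) + κ (L.minus F))) ^ 2 +
        κ (L.minus F) * (-(1 - κ (L.minus F) / (κ (L.plus F) + κ (L.minus F)))) ^ 2 =
        κ (L.plus F) * κ (L.minus F) / (κ (L.plus F) + κ (L.minus F)) := by
      field_simp
      ring
    rw [h3]
    apply div_le_div_of_nonneg_right _ (by positivity)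
    nlinarith [mul_pos h1 h2]
  · rw [if_neg hF, kappaFace, if_neg hF, L.nodeCoeff_of_not_isInterior κ hF]
    simp

theorem stiffness_self_nonneg (v : M.DG) : 0 ≤ stiffness M κ v v := by
  refine Finset.sum_nonneg fun T _ => ?_
  have h1 := hκ T
  have h2 : 0 ≤ M.cellVolume T := measureReal_nonneg
  have h3 : (0 : ℝ) ≤ inner ℝ (AffineMap.gradLinear (v T)) (AffineMap.gradLinear (v T)) :=
    real_inner_self_nonneg
  positivity

/-- The gradients are controlled by the weighted inner product. -/
theorem stiffness_combine_le (hm : 1 ≤ m) (s : SizeKind) {C₁ : ℝ}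
    (hC : ∀ (T : M.Cell) (F : M.Face), F.1 ⊆ T.1 → ‖M.oppGrad T F‖ * M.faceSize s F ≤ C₁)
    (a : M.Face → ℝ) :
    stiffness M κ (L.combine κ a) (L.combine κ a) ≤
      ((m + 1) * (m + 2) * C₁) * L.starInner κ s a a := by
  classical
  have hT : ∀ T : M.Cell, κ T * M.cellVolume T * inner ℝ (AffineMap.gradLinear (L.combine κ a T))
      (AffineMap.gradLinear (L.combine κ a T)) ≤ ∑ F ∈ M.facesOf T,
        (κ T * L.nodeCoeff κ T F ^ 2) *
          (((m + 1) * (m + 2) * C₁) * (M.area F / M.faceSize s F * a F ^ 2)) := by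
    intro T
    have hk := hκ T
    have hv : 0 ≤ M.cellVolume T := measureReal_nonneg
    -- Cauchy-Schwarz over the at most `d + 1 = m + 2` faces of `T`.
    have h1 : ‖∑ F ∈ M.facesOf T, L.combine κ a T (M.massCenter F) • M.oppGrad T F‖ ^ 2 ≤
        (m + 2) * ∑ F ∈ M.facesOf T, (L.nodeCoeff κ T F * a F) ^ 2 * ‖M.oppGrad T F‖ ^ 2 := by
      calc _ ≤ (∑ F ∈ M.facesOf T, ‖L.combine κ a T (M.massCenter F) • M.oppGrad T F‖) ^ 2 :=
            pow_le_pow_left₀ (norm_nonneg _) (norm_sum_le _ _) 2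
        _ ≤ (M.facesOf T).card * ∑ F ∈ M.facesOf T,
            ‖L.combine κ a T (M.massCenter F) • M.oppGrad T F‖ ^ 2 := sq_sum_le_card_mul_sum_sq
        _ = (M.facesOf T).card * ∑ F ∈ M.facesOf T,
            (L.nodeCoeff κ T F * a F) ^ 2 * ‖M.oppGrad T F‖ ^ 2 := by
          congr 1
          refine Finset.sum_congr rfl fun F hF => ?_
          rw [L.combine_massCenter κ a (M.mem_facesOf.mp hF), norm_smul, mul_pow, Real.norm_eq_abs,
            sq_abs]
        _ ≤ _ := by
          apply mul_le_mul_of_nonneg_right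
          · exact_mod_cast M.card_facesOf_le T
          · exact Finset.sum_nonneg fun F _ => by positivity
    rw [real_inner_self_eq_norm_sq, M.gradLinear_eq_sum T, norm_neg, norm_smul, mul_pow,
      Real.norm_eq_abs, sq_abs]
    calc _ ≤ κ T * M.cellVolume T * (((m : ℝ) + 1) ^ 2 * ((m + 2) *
          ∑ F ∈ M.facesOf T, (L.nodeCoeff κ T F * a F) ^ 2 * ‖M.oppGrad T F‖ ^ 2)) := by
          gcongr
      _ = ∑ F ∈ M.facesOf T, κ T * M.cellVolume T * (((m : ℝ) + 1) ^ 2 * ((m + 2) *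
          ((L.nodeCoeff κ T F * a F) ^ 2 * ‖M.oppGrad T F‖ ^ 2))) := by
          simp only [Finset.mul_sum]
      _ ≤ _ := by
          refine Finset.sum_le_sum fun F hF => ?_
          have hF' := M.mem_facesOf.mp hF
          have hs := M.faceSize_pos hm s F
          have hg : ‖M.oppGrad T F‖ ≤ C₁ / M.faceSize s F := by
            rw [le_div_iff₀ hs]
            exact hC T F hF'
          have ha := (M.area_pos F).le
          -- One of the two factors `‖∇λ‖` joins the volume to form `|F|`; the other is left to be
          -- bounded by `C₁ / h_F`.
          have e1 : κ T * M.cellVolume T * (((m : ℝ) + 1) ^ 2 * ((m + 2) *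
              ((L.nodeCoeff κ T F * a F) ^ 2 * ‖M.oppGrad T F‖ ^ 2))) =
              κ T * L.nodeCoeff κ T F ^ 2 * ((m + 1) * (m + 2) * a F ^ 2 * M.area F) *
                ‖M.oppGrad T F‖ := by
            rw [M.area_eq hF']
            ring
          have e2 : (κ T * L.nodeCoeff κ T F ^ 2) *
              (((m + 1) * (m + 2) * C₁) * (M.area F / M.faceSize s F * a F ^ 2)) =
              κ T * L.nodeCoeff κ T F ^ 2 * ((m + 1) * (m + 2) * a F ^ 2 * M.area F) *
                (C₁ / M.faceSize s F) := by ring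
          rw [e1, e2]
          gcongr
  refine (Finset.sum_le_sum fun T _ => hT T).trans ?_
  rw [L.sum_cells_facesOf, starInner, Finset.mul_sum]
  refine Finset.sum_le_sum fun F _ => ?_
  have hC₁ : 0 ≤ C₁ := le_trans
    (mul_nonneg (norm_nonneg _) (M.faceSize_pos hm s F).le) (hC _ F (L.subset_plus F))
  have hs := M.faceSize_pos hm s F
  have ha := (M.area_pos F).le
  have h := mul_le_mul_of_nonneg_right (L.sum_kappa_nodeCoeff_sq_le hκ F)
    (by positivity : 0 ≤ ((m + 1) * (m + 2) * C₁) * (M.area F / M.faceSize s F * a F ^ 2))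
  refine le_trans (le_of_eq ?_) (h.trans (le_of_eq ?_))
  · split_ifs <;> ring
  · rw [starWeight]
    ring

end Positive

/-- The form `A₀` on `Z_β` in terms of the coefficients. -/
noncomputable def coeffForm (s : SizeKind) (θ α : ℝ) :
    (M.Face → ℝ) →ₗ[ℝ] (M.Face → ℝ) →ₗ[ℝ] ℝ :=
  LinearMap.mk₂ ℝ
    (fun a b => θ * stiffness M κ (L.combine κ a) (L.combine κ b) + α * L.starInner κ s a b)
    (fun a a' b => by
      simp only [stiffness, starInner, map_add, Pi.add_apply, inner_add_left, mul_add, add_mul,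
        Finset.sum_add_distrib]
      ring)
    (fun c a b => by
      simp only [stiffness, starInner, map_smul, Pi.smul_apply, real_inner_smul_left, smul_eq_mul,
        mul_add, Finset.mul_sum]
      congr 1 <;> exact Finset.sum_congr rfl fun _ _ => by ring)
    (fun a b b' => by
      simp only [stiffness, starInner, map_add, Pi.add_apply, inner_add_right, mul_add,
        Finset.sum_add_distrib]
      ring)
    (fun c a b => by
      simp only [stiffness, starInner, map_smul, Pi.smul_apply, real_inner_smul_right, smul_eq_mul,
        mul_add, Finset.mul_sum]
      congr 1 <;> exact Finset.sum_congr rfl fun _ _ => by ring)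

theorem formA0_eq_coeffForm (s : SizeKind) (θ α : ℝ) (a b : M.Face → ℝ) :
    L.formA0 κ s θ α (L.combine κ a) (L.combine κ b) = L.coeffForm κ s θ α a b :=
  L.formA0_combine κ s θ α a b

theorem coeffForm_comm (s : SizeKind) (θ α : ℝ) (a b : M.Face → ℝ) :
    L.coeffForm κ s θ α a b = L.coeffForm κ s θ α b a := by
  change θ * _ + α * _ = θ * _ + α * _
  rw [stiffness_comm]
  congr 2
  exact Finset.sum_congr rfl fun F _ => by ring

open Classical in
theorem matrixZZ_apply (s : SizeKind) (θ α : ℝ) (F G : M.Face) :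
    L.matrixZZ κ s θ α F G =
      L.coeffForm κ s θ α (Pi.single G 1) (Pi.single F 1) := by
  rw [← formA0_eq_coeffForm]
  simp [matrixZZ, combine, Fintype.linearCombination_apply_single]

theorem dotProduct_matrixZZ_mulVec (s : SizeKind) (θ α : ℝ) (a b : M.Face → ℝ) :
    a ⬝ᵥ (L.matrixZZ κ s θ α *ᵥ b) = L.coeffForm κ s θ α b a := by
  classical
  conv_rhs => rw [pi_eq_sum_univ' a, pi_eq_sum_univ' b]
  simp only [map_sum, map_smul, LinearMap.sum_apply, LinearMap.smul_apply, smul_eq_mul]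
  simp only [dotProduct, Matrix.mulVec, matrixZZ_apply, Finset.mul_sum]
  exact Finset.sum_congr rfl fun F _ => Finset.sum_congr rfl fun G _ => by ring

theorem matrixZZ_isHermitian (s : SizeKind) (θ α : ℝ) : (L.matrixZZ κ s θ α).IsHermitian := by
  classical
  ext F G
  rw [Matrix.conjTranspose_apply, star_trivial, matrixZZ_apply, matrixZZ_apply, coeffForm_comm]

end Labelling

end SimplicialMesh

namespace SimplicialMesh

/-! ### Shape regularity bounds face size times barycentric gradient -/

section ShapeRegularity

variable {m : ℕ} (M : SimplicialMesh (m + 1))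

/-- Along the diameter of the ball in the direction of the gradient the barycentric coordinate grows
by `2 r ‖∇λ‖`, yet it stays in `[0, 1]` on the simplex. -/
theorem two_mul_radius_mul_oppGrad_le {T : M.Cell} {F : M.Face} (hF : F.1 ⊆ T.1)
    {x : Euc (m + 1)} {r : ℝ} (hr : 0 < r) (hball : Metric.closedBall x r ⊆ hull T.1) :
    2 * r * ‖M.oppGrad T F‖ ≤ 1 := by
  set g := M.oppGrad T F with hg
  have hpos : 0 < ‖g‖ := norm_pos_iff.mpr (M.oppGrad_ne_zero hF)
  have hn : ‖(r * ‖g‖⁻¹) • g‖ = r := by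
    rw [norm_smul, norm_mul, norm_inv, norm_norm, Real.norm_eq_abs, abs_of_pos hr,
      inv_mul_cancel_right₀ hpos.ne']
  have hadd : x + (r * ‖g‖⁻¹) • g ∈ Metric.closedBall x r := by
    rw [Metric.mem_closedBall, dist_self_add_left, hn]
  have hsub : x - (r * ‖g‖⁻¹) • g ∈ Metric.closedBall x r := by
    rw [Metric.mem_closedBall, dist_self_sub_left, hn]
  have h1 := (M.oppCoord_mem_Icc hF (hball hadd)).2
  have h2 := (M.oppCoord_mem_Icc hF (hball hsub)).1
  have h3 := M.inner_oppGrad_sub T F (x + (r * ‖g‖⁻¹) • g) (x - (r * ‖g‖⁻¹) • g)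
  have h4 : x + (r * ‖g‖⁻¹) • g - (x - (r * ‖g‖⁻¹) • g) = (2 * (r * ‖g‖⁻¹)) • g := by module
  rw [h4, ← hg, real_inner_smul_right, real_inner_self_eq_norm_sq] at h3
  have h5 : 2 * (r * ‖g‖⁻¹) * ‖g‖ ^ 2 = 2 * r * ‖g‖ := by
    field_simp
  linarith

variable {M}

theorem ShapeRegular.oppGrad_mul_diam_le {σ : ℝ} (hσ : M.ShapeRegular σ) {T : M.Cell} {F : M.Face}
    (hF : F.1 ⊆ T.1) : ‖M.oppGrad T F‖ * Metric.diam (hull F.1) ≤ |σ| := by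
  obtain ⟨x, r, hr, hball, hdiam⟩ := hσ T
  have h1 := M.two_mul_radius_mul_oppGrad_le hF hr hball
  have h2 : Metric.diam (hull F.1) ≤ Metric.diam (hull T.1) :=
    Metric.diam_mono (convexHull_mono (Finset.coe_subset.mpr hF)) (isBounded_hull T.1)
  have h3 : Metric.diam (hull F.1) ≤ |σ| * (2 * r) :=
    h2.trans (hdiam.trans (mul_le_mul_of_nonneg_right (le_abs_self σ) (by positivity)))
  calc _ ≤ ‖M.oppGrad T F‖ * (|σ| * (2 * r)) := by gcongr
    _ = |σ| * (2 * r * ‖M.oppGrad T F‖) := by ring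
    _ ≤ |σ| * 1 := by gcongr
    _ = |σ| := mul_one _

theorem Triangulates.diam_face_le {Ω : Set (Euc (m + 1))} (hΩ : Bornology.IsBounded Ω)
    (h : M.Triangulates Ω) (F : M.Face) : Metric.diam (hull F.1) ≤ Metric.diam (closure Ω) := by
  obtain ⟨T, hT⟩ := M.face_exists_cell F
  apply Metric.diam_mono _ hΩ.closure
  rw [Triangulates] at h
  rw [h]
  exact (convexHull_mono (Finset.coe_subset.mpr hT)).trans
    (Set.subset_iUnion (fun T : M.Cell => hull T.1) T)

/-- On shape regular meshes of a bounded domain, the size of a face is at most a constant times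
the height of the adjacent simplices over it. -/
theorem oppGrad_mul_faceSize_le (hm : 1 ≤ m) {Ω : Set (Euc (m + 1))} (hΩ : Bornology.IsBounded Ω)
    (hT : M.Triangulates Ω) {σ : ℝ} (hσ : M.ShapeRegular σ) (s : SizeKind) {T : M.Cell}
    {F : M.Face} (hF : F.1 ⊆ T.1) :
    ‖M.oppGrad T F‖ * M.faceSize s F ≤
      |σ| * (1 + (volume : Measure (Euc m)).real (Metric.closedBall 0 1) *
        Metric.diam (closure Ω) ^ (m - 1)) := by
  have h1 := hσ.oppGrad_mul_diam_le hF
  set ω := (volume : Measure (Euc m)).real (Metric.closedBall 0 1) with hω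
  have hω0 : 0 ≤ ω := measureReal_nonneg
  have hR : 0 ≤ Metric.diam (closure Ω) := Metric.diam_nonneg
  have hσ0 := abs_nonneg σ
  cases s with
  | diameter =>
    refine h1.trans (le_mul_of_one_le_right hσ0 ?_)
    have : 0 ≤ ω * Metric.diam (closure Ω) ^ (m - 1) := by positivity
    linarith
  | measure =>
    have hd : 0 ≤ Metric.diam (hull F.1) := Metric.diam_nonneg
    -- Of the `m` powers of the diameter one is kept for shape regularity and the other `m - 1` are
    -- bounded by the diameter of the domain, which is how `Ω` enters the constants.
    have h2 : M.area F ≤ ω * (Metric.diam (hull F.1) * Metric.diam (closure Ω) ^ (m - 1)) := by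
      refine (M.area_le F).trans (mul_le_mul_of_nonneg_left ?_ hω0)
      obtain ⟨n, rfl⟩ : ∃ n, m = n + 1 := ⟨m - 1, by omega⟩
      rw [pow_succ', Nat.add_sub_cancel]
      have := hT.diam_face_le hΩ F
      gcongr
    calc ‖M.oppGrad T F‖ * M.area F
        ≤ ‖M.oppGrad T F‖ * (ω * (Metric.diam (hull F.1) * Metric.diam (closure Ω) ^ (m - 1))) := by
          gcongr
      _ = (‖M.oppGrad T F‖ * Metric.diam (hull F.1)) *
          (ω * Metric.diam (closure Ω) ^ (m - 1)) := by ring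
      _ ≤ |σ| * (ω * Metric.diam (closure Ω) ^ (m - 1)) := by gcongr
      _ ≤ _ := by
          gcongr
          linarith

end ShapeRegularity

/-! ### Spectral equivalence and convergence for the stiffness matrix -/

namespace Labelling

variable {m : ℕ} {M : SimplicialMesh (m + 1)} (L : M.Labelling) {κ : M.Cell → ℝ}

theorem starInner_self (κ : M.Cell → ℝ) (s : SizeKind) (a : M.Face → ℝ) :
    L.starInner κ s a a = ∑ F, L.starWeight κ s F * a F ^ 2 :=
  Finset.sum_congr rfl fun F _ => by ring

theorem starInner_self_pos (hm : 1 ≤ m) (hκ : ∀ T, 0 < κ T) (s : SizeKind) {a : M.Face → ℝ}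
    (ha : a ≠ 0) : 0 < L.starInner κ s a a := by
  obtain ⟨F, hF⟩ := Function.ne_iff.mp ha
  rw [starInner_self]
  apply Finset.sum_pos'
  · intro G _
    have := L.starWeight_pos hκ hm s G
    positivity
  · have := L.starWeight_pos hκ hm s F
    have hF' : a F ≠ 0 := hF
    exact ⟨F, Finset.mem_univ _, by positivity⟩

theorem matrixZZ_posDef (hm : 1 ≤ m) (hκ : ∀ T, 0 < κ T) (s : SizeKind) {θ α c : ℝ} (hc : 0 < c)
    (hlow : ∀ a, c * L.starInner κ s a a ≤ L.coeffForm κ s θ α a a) :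
    (L.matrixZZ κ s θ α).PosDef := by
  refine Matrix.PosDef.of_dotProduct_mulVec_pos (L.matrixZZ_isHermitian κ s θ α) fun a ha => ?_
  rw [star_trivial, dotProduct_matrixZZ_mulVec]
  exact (mul_pos hc (L.starInner_self_pos hm hκ s ha)).trans_le (hlow a)

open Classical in
theorem starInner_single (κ : M.Cell → ℝ) (s : SizeKind) (F : M.Face) :
    L.starInner κ s (Pi.single F 1) (Pi.single F 1) = L.starWeight κ s F := by
  rw [starInner_self, Finset.sum_eq_single F]
  · simp
  · intro G _ hG
    simp [Pi.single_eq_of_ne hG]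
  · simp

/-- Uniform convergence of diagonally preconditioned CG from spectral equivalence. -/
theorem energyNorm_pcgIterate_matrixZZ_le (hm : 1 ≤ m) (hκ : ∀ T, 0 < κ T) (s : SizeKind)
    {θ α c C : ℝ} (hc : 0 < c) (hC : 0 < C)
    (hlow : ∀ a, c * L.starInner κ s a a ≤ L.coeffForm κ s θ α a a)
    (hupp : ∀ a, L.coeffForm κ s θ α a a ≤ C * L.starInner κ s a a) {D : M.Face → ℝ}
    (hD : D = (fun F => L.matrixZZ κ s θ α F F) ∨ D = L.starWeight κ s)
    {b x : M.Face → ℝ} (hx : L.matrixZZ κ s θ α *ᵥ x = b) (x₀ : M.Face → ℝ) (k : ℕ) :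
    energyNorm (L.matrixZZ κ s θ α) (x - pcgIterate (L.matrixZZ κ s θ α) D b x₀ k) ≤
      √(1 - min (c / C) ((c / C) ^ 2)) ^ k * energyNorm (L.matrixZZ κ s θ α) (x - x₀) := by
  classical
  have hA := L.matrixZZ_posDef hm hκ s hc hlow
  have hw := L.starWeight_pos hκ hm s
  rcases hD with rfl | rfl
  · have hdiag : ∀ F, L.matrixZZ κ s θ α F F =
        L.coeffForm κ s θ α (Pi.single F 1) (Pi.single F 1) := fun F => L.matrixZZ_apply κ s θ α F F
    have h1 : ∀ F, c * L.starWeight κ s F ≤ L.matrixZZ κ s θ α F F := fun F => by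
      rw [hdiag, ← starInner_single]; exact hlow _
    have h2 : ∀ F, L.matrixZZ κ s θ α F F ≤ C * L.starWeight κ s F := fun F => by
      rw [hdiag, ← starInner_single]; exact hupp _
    have hDpos : ∀ F, 0 < L.matrixZZ κ s θ α F F := fun F => (mul_pos hc (hw F)).trans_le (h1 F)
    -- Testing the equivalence on unit vectors puts each diagonal entry between `c` and `C` times
    -- its weight, so relative to the diagonal the constants become `c / C` and `C / c`. Their ratio
    -- is `(c / C) ^ 2`; the minimum in the rate covers both preconditioners.
    refine energyNorm_pcgIterate_le hA hDpos (c := c / C) (C := C / c) (by positivity)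
      (by positivity) (fun u => ?_) (fun u => ?_) ?_ hx x₀ k
    · rw [dotProduct_matrixZZ_mulVec]
      refine le_trans ?_ (hlow u)
      rw [starInner_self, div_mul_eq_mul_div, div_le_iff₀ hC, mul_assoc]
      apply mul_le_mul_of_nonneg_left _ hc.le
      rw [Finset.sum_mul]
      refine Finset.sum_le_sum fun F _ => ?_
      nlinarith [mul_le_mul_of_nonneg_right (h2 F) (sq_nonneg (u F))]
    · rw [dotProduct_matrixZZ_mulVec]
      refine (hupp u).trans ?_
      rw [starInner_self, div_mul_eq_mul_div, le_div_iff₀ hc, mul_assoc]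
      apply mul_le_mul_of_nonneg_left _ hC.le
      rw [Finset.sum_mul]
      refine Finset.sum_le_sum fun F _ => ?_
      nlinarith [mul_le_mul_of_nonneg_right (h1 F) (sq_nonneg (u F))]
    · have h3 : c / C / (C / c) = (c / C) ^ 2 := by field_simp
      rw [h3]
      linarith [min_le_right (c / C) ((c / C) ^ 2)]
  · refine energyNorm_pcgIterate_le hA hw hc hC (fun u => ?_) (fun u => ?_) ?_ hx x₀ k
    · rw [dotProduct_matrixZZ_mulVec, ← starInner_self]
      exact hlow u
    · rw [dotProduct_matrixZZ_mulVec, ← starInner_self]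
      exact hupp u
    · linarith [min_le_left (c / C) ((c / C) ^ 2)]

/-- The spectral equivalence of the form on `Z_β` with the weighted inner product. -/
theorem coeffForm_bounds (hκ : ∀ T, 0 < κ T) (s : SizeKind) {θ α C₀ : ℝ}
    (hθ : θ = -1 ∨ θ = 0 ∨ θ = 1) (hα₀ : θ ≠ 1 → C₀ + 1 ≤ α) (hC₀ : 0 ≤ C₀)
    (hstar : ∀ a, 0 ≤ L.starInner κ s a a)
    (hstiff : ∀ a, stiffness M κ (L.combine κ a) (L.combine κ a) ≤ C₀ * L.starInner κ s a a)
    (a : M.Face → ℝ) :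
    min α 1 * L.starInner κ s a a ≤ L.coeffForm κ s θ α a a ∧
      L.coeffForm κ s θ α a a ≤ (α + C₀) * L.starInner κ s a a := by
  have h1 := hstiff a
  have h2 := stiffness_self_nonneg hκ (L.combine κ a)
  have h3 := hstar a
  have h4 : L.coeffForm κ s θ α a a =
    θ * stiffness M κ (L.combine κ a) (L.combine κ a) + α * L.starInner κ s a a := rfl
  have h5 := mul_le_mul_of_nonneg_right (min_le_left α 1) h3
  have h6 := mul_le_mul_of_nonneg_right (min_le_right α 1) h3
  have h7 := mul_nonneg hC₀ h3
  rw [h4]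
  -- For `θ = -1` the volume form is subtracted, and `α - C₀ ≥ 1` supplies the lower constant;
  -- otherwise it is absent or helps, and the lower constant is `α`.
  rcases hθ with rfl | rfl | rfl
  · have h8 := mul_le_mul_of_nonneg_right (hα₀ (by norm_num)) h3
    constructor <;> nlinarith
  · constructor <;> nlinarith
  · constructor <;> nlinarith

end Labelling

end SimplicialMesh

/-! ### The theorem -/

theorem lemma4p2 (d : ℕ) (hd : 2 ≤ d) (Ω : Set (Euc d)) (hΩ : IsOpen Ω)
    (hΩb : Bornology.IsBounded Ω) (σ : ℝ) (θ : ℝ) (hθ : θ = -1 ∨ θ = 0 ∨ θ = 1)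
    (s : SimplicialMesh.SizeKind) :
    ∃ α₀ : ℝ, 0 < α₀ ∧ ∀ α : ℝ, 0 < α → (θ ≠ 1 → α₀ ≤ α) →
      ∃ c C ρ : ℝ, 0 < c ∧ 0 < C ∧ 0 ≤ ρ ∧ ρ < 1 ∧
        ∀ M : SimplicialMesh d, M.Triangulates Ω → M.ShapeRegular σ →
        ∀ (L : M.Labelling) (κ : M.Cell → ℝ), (∀ T, 0 < κ T) →
          -- spectral equivalence on `Z_β`
          (∀ z ∈ L.spaceZ κ,
            (∃! a : M.Face → ℝ, z = ∑ F, a F • L.psi κ F) ∧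
            ∀ a : M.Face → ℝ, z = ∑ F, a F • L.psi κ F →
              c * L.starInner κ s a a ≤ L.formA0 κ s θ α z z ∧
              L.formA0 κ s θ α z z ≤ C * L.starInner κ s a a) ∧
          -- uniform convergence of diagonally preconditioned CG on the `Z_β` block
          (L.matrixZZ κ s θ α).PosDef ∧
          ∀ D : M.Face → ℝ,
            (D = (fun F => L.matrixZZ κ s θ α F F) ∨ D = L.starWeight κ s) →
            ∀ b x₀ x : M.Face → ℝ, L.matrixZZ κ s θ α *ᵥ x = b → ∀ k : ℕ,
              energyNorm (L.matrixZZ κ s θ α) (x - pcgIterate (L.matrixZZ κ s θ α) D b x₀ k) ≤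
                ρ ^ k * energyNorm (L.matrixZZ κ s θ α) (x - x₀) := by
  obtain ⟨m, rfl⟩ : ∃ m, d = m + 1 := ⟨d - 1, by omega⟩
  have hm : 1 ≤ m := by omega
  set C₁ : ℝ := |σ| * (1 + (volume : Measure (Euc m)).real (Metric.closedBall 0 1) *
    Metric.diam (closure Ω) ^ (m - 1)) with hC₁
  have hC₁0 : 0 ≤ C₁ := by
    have h1 : 0 ≤ (volume : Measure (Euc m)).real (Metric.closedBall 0 1) := measureReal_nonneg
    have h2 : 0 ≤ Metric.diam (closure Ω) := Metric.diam_nonneg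
    positivity
  set C₀ : ℝ := (m + 1) * (m + 2) * C₁ with hC₀
  have hC₀0 : 0 ≤ C₀ := by positivity
  -- The excess of `1` over `C₀` is the coercivity constant left for `θ = -1`.
  refine ⟨C₀ + 1, by positivity, fun α hα hα₀ => ?_⟩
  have hc : 0 < min α 1 := lt_min hα one_pos
  have hC : 0 < α + C₀ := by positivity
  refine ⟨min α 1, α + C₀, √(1 - min (min α 1 / (α + C₀)) ((min α 1 / (α + C₀)) ^ 2)), hc, hC,
    Real.sqrt_nonneg _, ?_, ?_⟩
  · rw [Real.sqrt_lt' one_pos]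
    have : 0 < min (min α 1 / (α + C₀)) ((min α 1 / (α + C₀)) ^ 2) :=
      lt_min (by positivity) (by positivity)
    linarith
  · intro M hM hσ L κ hκ
    have hstiff := L.stiffness_combine_le hκ hm s
      (fun T F hF => SimplicialMesh.oppGrad_mul_faceSize_le hm hΩb hM hσ s hF)
    have hstar : ∀ a, 0 ≤ L.starInner κ s a a := fun a => by
      rcases eq_or_ne a 0 with rfl | ha
      · simp [SimplicialMesh.Labelling.starInner]
      · exact (L.starInner_self_pos hm hκ s ha).le
    have hbounds := L.coeffForm_bounds hκ s hθ hα₀ hC₀0 hstar hstiff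
    have hlow := fun a => (hbounds a).1
    have hupp := fun a => (hbounds a).2
    refine ⟨fun z hz => ⟨?_, ?_⟩, L.matrixZZ_posDef hm hκ s hc hlow, ?_⟩
    · obtain ⟨a, rfl⟩ := L.exists_combine_eq hz
      exact ⟨a, rfl, fun b hb => (L.combine_injective hκ hb).symm⟩
    · rintro a rfl
      rw [← L.combine_eq, L.formA0_eq_coeffForm]
      exact hbounds a
    · intro D hD b x₀ x hx k
      exact L.energyNorm_pcgIterate_matrixZZ_le hm hκ s hc hC hlow hupp hD hx x₀ k
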